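/- Conventions. Let $X$ be a complex manifold (Hausdorff, second countable, pure-dimensional; connectedness is not needed), $m\ge 0$, and $w\in H^0(X,S^m\Omega^1_X)$ a symmetric differential of degree $m$. - $w$ is *of the 1st kind* if every $x\in X$ has a neighbourhood on which $w=\mu_1\cdots\mu_m$ with closed holomorphic 1-forms $\mu_i$ (a holomorphic closed decomposition of $w$ at $x$). - An *abelian relation* at $x$ of a holomorphic closed decomposition $w=\mu_1\cdots\mu_m$ at $x$ is an $m$-tuple $(f_1,\dots,f_m)$ of germs of meromorphic functions at $x$ with $\sum_i f_i\mu_i=0$ and $df_i\wedge\mu_i=0$ for all $i$. The *abelian rank of $w$ is trivial* if, for all $x$ outside some nowhere dense analytic subset of $X$, $w$ has a holomorphic closed decomposition at $x$ whose only abelian relation at $x$ is $(0,\dots,0)$. - $w$ is *split* if $w=\psi_1\cdots\psi_m$ with meromorphic 1-forms $\psi_i$ on $X$, or if $w=\mu_1\cdots\mu_m$ with $\mu_i\in H^0(X,\Omega^1_X\otimes L_i)$ for holomorphic line bundles $L_i$ on $X$ and an isomorphism $L_1\otimes\cdots\otimes L_m\simeq\mathcal O_X$. - For a complex manifold $Y$,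 write $\Omega^1_{Y,cl}$ for the sheaf of closed holomorphic 1-forms on $Y$, and $\mathbb C$ for the constant local system. A *twisted closed decomposition* of a symmetric differential $v$ of degree $m$ on $Y$ consists of local systems $\mathbb C_{\rho_1},\dots,\mathbb C_{\rho_m}$ of complex vector spaces of rank 1 on $Y$, an isomorphism of local systems $\mathbb C_{\rho_1}\otimes\cdots\otimes\mathbb C_{\rho_m}\simeq\mathbb C$, and twisted closed holomorphic 1-forms $\phi_i\in H^0(Y,\Omega^1_{Y,cl}\otimes\mathbb C_{\rho_i})$ such that $v=\phi_1\cdots\phi_m$ through this isomorphism. **Corollary 1.2.** Let $w\in H^0(X,S^m\Omega^1_X)$ be of the 1st kind with trivial abelian rank. Then there are a complex manifold $X'$ and a finite unramified cover $f:X'\to X$ (a surjective, locally biholomorphic covering map with finite fibres), with $X'$ connected if $X$ is connected, such that $f^*w$ has a twisted closed decomposition on $X'$. If $w$ is split, then $w$ itself has a twisted closed decomposition on $X$, so no cover is needed. -/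

import Mathlib

open scoped Manifold ContDiff Topology

universe u

namespace SymDiff

/-! Complex manifolds of dimension `n` are manifolds of class `ω` (analytic over `ℂ`) modelled on
`ℂⁿ = Fin n → ℂ`. All fields below are total functions of the point; the conditions on them are
imposed near a point or on an open set only. -/

section Basic

variable {n m : ℕ} {X : Type u} [TopologicalSpace X] [ChartedSpace (Fin n → ℂ) X]

/-- A (not yet holomorphic) field of complex linear forms on the holomorphic tangent spaces. -/
abbrev OneForm (n : ℕ) (X : Type u) [TopologicalSpace X] [ChartedSpace (Fin n → ℂ) X] : Type u :=
  ∀ x : X, TangentSpace 𝓘(ℂ, Fin n → ℂ) x →L[ℂ] ℂ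

/-- A (not yet holomorphic, not yet symmetric) field of `m`-linear forms on the tangent spaces. -/
abbrev TensorField (n m : ℕ) (X : Type u) [TopologicalSpace X] [ChartedSpace (Fin n → ℂ) X] :
    Type u :=
  ∀ x : X, ContinuousMultilinearMap ℂ (fun _ : Fin m => TangentSpace 𝓘(ℂ, Fin n → ℂ) x) ℂ

/-- The function `f` is holomorphic in a neighbourhood of `x`. -/
def IsHolomorphicAt (n : ℕ) {X : Type u} [TopologicalSpace X] [ChartedSpace (Fin n → ℂ) X]
    (f : X → ℂ) (x : X) : Prop :=
  ContMDiffAt 𝓘(ℂ, Fin n → ℂ) 𝓘(ℂ) ω f x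

/-- The function `f` is constant in a neighbourhood of `x`. -/
def IsLocallyConstantAt {X : Type u} [TopologicalSpace X] (f : X → ℂ) (x : X) : Prop :=
  ∀ᶠ y in 𝓝 x, f y = f x

/-- The expression of the 1-form `μ` in the preferred chart at `x₀`, that is, the pullback of `μ`
under the inverse of that chart; it is meaningful on the target of the chart. -/
noncomputable def OneForm.coord (μ : OneForm n X) (x₀ : X) (z : Fin n → ℂ) :
    (Fin n → ℂ) →L[ℂ] ℂ :=
  (μ ((chartAt (Fin n → ℂ) x₀).symm z)).comp
    (mfderiv 𝓘(ℂ, Fin n → ℂ) 𝓘(ℂ, Fin n → ℂ) (chartAt (Fin n → ℂ) x₀).symm z)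

/-- The expression of the tensor field `w` in the preferred chart at `x₀`. -/
noncomputable def TensorField.coord (w : TensorField n m X) (x₀ : X) (z : Fin n → ℂ) :
    ContinuousMultilinearMap ℂ (fun _ : Fin m => (Fin n → ℂ)) ℂ :=
  (w ((chartAt (Fin n → ℂ) x₀).symm z)).compContinuousLinearMap
    (fun _ => mfderiv 𝓘(ℂ, Fin n → ℂ) 𝓘(ℂ, Fin n → ℂ) (chartAt (Fin n → ℂ) x₀).symm z)

/-- The 1-form `μ` is holomorphic in a neighbourhood of `x`. -/
def OneForm.IsHolomorphicAt (μ : OneForm n X) (x : X) : Prop :=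
  AnalyticAt ℂ (μ.coord x) (chartAt (Fin n → ℂ) x x)

/-- `dμ = 0` at the point `x`: in coordinates, `dμ (u, v) = (D_u μ) v - (D_v μ) u`. -/
def OneForm.IsClosedAt (μ : OneForm n X) (x : X) : Prop :=
  ∀ u v : Fin n → ℂ,
    fderiv ℂ (μ.coord x) (chartAt (Fin n → ℂ) x x) u v =
      fderiv ℂ (μ.coord x) (chartAt (Fin n → ℂ) x x) v u

/-- `μ` is holomorphic near `x`, and `dμ` vanishes at `x`. A closed holomorphic 1-form on an open
set is one that has this property at all points of the set. -/
def OneForm.IsClosedHolomorphicAt (μ : OneForm n X) (x : X) : Prop :=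
  μ.IsHolomorphicAt x ∧ μ.IsClosedAt x

/-- `w ∈ H⁰(X, SᵐΩ¹)`: a holomorphic field of symmetric `m`-linear forms. -/
def IsSymmetricDifferential (w : TensorField n m X) : Prop :=
  (∀ (x : X) (σ : Equiv.Perm (Fin m)) (v : Fin m → TangentSpace 𝓘(ℂ, Fin n → ℂ) x),
      w x (fun i => v (σ i)) = w x v) ∧
    ∀ x : X, AnalyticAt ℂ (w.coord x) (chartAt (Fin n → ℂ) x x)

/-- The symmetric product `α₁ ⋯ αₘ` of linear forms at a point, as a symmetric `m`-linear form:
`(v₁, …, vₘ) ↦ (1 / m!) ∑_σ ∏ᵢ α_{σ i} (vᵢ)`. On the diagonal it is `v ↦ ∏ᵢ αᵢ (v)`. -/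
noncomputable def symProd {x : X} (α : Fin m → TangentSpace 𝓘(ℂ, Fin n → ℂ) x →L[ℂ] ℂ) :
    ContinuousMultilinearMap ℂ (fun _ : Fin m => TangentSpace 𝓘(ℂ, Fin n → ℂ) x) ℂ :=
  ((m.factorial : ℂ))⁻¹ • ∑ σ : Equiv.Perm (Fin m),
    (ContinuousMultilinearMap.mkPiAlgebra ℂ (Fin m) ℂ).compContinuousLinearMap
      (fun i => α (σ i))

/-- The pullback `f^* w` of a tensor field. -/
noncomputable def TensorField.pullback {X' : Type u} [TopologicalSpace X']
    [ChartedSpace (Fin n → ℂ) X'] (f : X' → X) (w : TensorField n m X) : TensorField n m X' :=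
  fun x => (w (f x)).compContinuousLinearMap
    (fun _ => mfderiv 𝓘(ℂ, Fin n → ℂ) 𝓘(ℂ, Fin n → ℂ) f x)

/-! ### Closed decompositions -/

/-- `w = μ₁ ⋯ μₘ` with closed holomorphic 1-forms `μᵢ` on a neighbourhood of `x`. -/
def IsClosedDecompositionAt (w : TensorField n m X) (μ : Fin m → OneForm n X) (x : X) : Prop :=
  ∃ U : Set X, IsOpen U ∧ x ∈ U ∧ (∀ i, ∀ y ∈ U, (μ i).IsClosedHolomorphicAt y) ∧
    ∀ y ∈ U, w y = symProd (fun i => μ i y)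

/-- `w` is of the 1st kind: it has a holomorphic closed decomposition at every point. -/
def IsFirstKind (w : TensorField n m X) : Prop :=
  ∀ x : X, ∃ μ : Fin m → OneForm n X, IsClosedDecompositionAt w μ x

/-! ### Abelian relations -/

/-- A meromorphic germ at `x`, written as a fraction of holomorphic germs with nonzero
denominator. -/
structure MeromorphicGerm (n : ℕ) {X : Type u} [TopologicalSpace X]
    [ChartedSpace (Fin n → ℂ) X] (x : X) where
  num : X → ℂ
  den : X → ℂ
  num_holomorphic : IsHolomorphicAt n num x
  den_holomorphic : IsHolomorphicAt n den x
  den_ne_zero : ∃ᶠ y in 𝓝 x, den y ≠ 0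

/-- The value of the fraction, meaningful off the zeros of the denominator. -/
noncomputable def MeromorphicGerm.val {x : X} (f : MeromorphicGerm n x) (y : X) : ℂ :=
  f.num y / f.den y

/-- The meromorphic germ is zero. -/
def MeromorphicGerm.IsZero {x : X} (f : MeromorphicGerm n x) : Prop :=
  ∀ᶠ y in 𝓝 x, f.num y = 0

/-- The differential `dh` of a function, as a field of linear forms; it is meaningful where `h` is
holomorphic. -/
noncomputable def differential (n : ℕ) {X : Type u} [TopologicalSpace X]
    [ChartedSpace (Fin n → ℂ) X] (h : X → ℂ) : OneForm n X :=
  fun y => mfderiv 𝓘(ℂ, Fin n → ℂ) 𝓘(ℂ) h y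

/-- `(f₁, …, fₘ)` is an abelian relation at `x` of the decomposition with factors `μ₁, …, μₘ`:
`∑ᵢ fᵢ μᵢ = 0` and `dfᵢ ∧ μᵢ = 0`, as identities of meromorphic germs at `x`. -/
def IsAbelianRelation {x : X} (μ : Fin m → OneForm n X) (f : Fin m → MeromorphicGerm n x) :
    Prop :=
  (∀ᶠ y in 𝓝 x, (∀ i, (f i).den y ≠ 0) → ∑ i, (f i).val y • μ i y = 0) ∧
    ∀ i, ∀ᶠ y in 𝓝 x, (f i).den y ≠ 0 →
      ∀ u v : TangentSpace 𝓘(ℂ, Fin n → ℂ) y,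
        differential n (f i).val y u * μ i y v - differential n (f i).val y v * μ i y u = 0

/-- The space of abelian relations at `x` of the decomposition with factors `μ₁, …, μₘ` is
zero. -/
def HasOnlyTrivialAbelianRelations (μ : Fin m → OneForm n X) (x : X) : Prop :=
  ∀ f : Fin m → MeromorphicGerm n x, IsAbelianRelation μ f → ∀ i, (f i).IsZero

/-- `R` is an analytic subset of `X`: near every point of `X` it is the set of common zeros of
finitely many holomorphic functions. -/
def IsAnalyticSubset (n : ℕ) {X : Type u} [TopologicalSpace X] [ChartedSpace (Fin n → ℂ) X]
    (R : Set X) : Prop :=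
  ∀ x : X, ∃ U : Set X, IsOpen U ∧ x ∈ U ∧ ∃ (k : ℕ) (g : Fin k → X → ℂ),
    (∀ i, ∀ y ∈ U, IsHolomorphicAt n (g i) y) ∧ ∀ y ∈ U, y ∈ R ↔ ∀ i, g i y = 0

/-- The abelian rank of `w` is zero: at the general point `x`, that is, for all `x` off a nowhere
dense analytic subset, `w` has a holomorphic closed decomposition at `x` all of whose abelian
relations are zero. (The abelian rank at a general point does not depend on the decomposition.) -/
def HasTrivialAbelianRank (w : TensorField n m X) : Prop :=
  ∃ R : Set X, IsAnalyticSubset n R ∧ interior R = ∅ ∧ ∀ x, x ∉ R →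
    ∃ μ : Fin m → OneForm n X, IsClosedDecompositionAt w μ x ∧
      HasOnlyTrivialAbelianRelations μ x

/-! ### Line bundles, local systems, and forms with values in them -/

/-- A rank 1 object given by a 1-cocycle on the cover `U`, with local frames `e_a` over `U a` and
`e_b = g a b • e_a` over `U a ∩ U b`; the transition functions are nowhere zero and of class `P`.
For `P` holomorphic this is a holomorphic line bundle, for `P` locally constant it is a local system
of 1-dimensional complex vector spaces. -/
structure RankOneCocycle {X : Type u} (P : (X → ℂ) → X → Prop) {ι : Type u} (U : ι → Set X) where
  g : ι → ι → X → ℂ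
  ne_zero : ∀ a b, ∀ x ∈ U a ∩ U b, g a b x ≠ 0
  regular : ∀ a b, ∀ x ∈ U a ∩ U b, P (g a b) x
  cocycle : ∀ a b c, ∀ x ∈ U a ∩ U b ∩ U c, g a b x * g b c x = g a c x

/-- A holomorphic line bundle that is trivialized over the members of the cover `U`. -/
abbrev LineBundle (n : ℕ) {X : Type u} [TopologicalSpace X] [ChartedSpace (Fin n → ℂ) X]
    {ι : Type u} (U : ι → Set X) : Type u :=
  RankOneCocycle (IsHolomorphicAt n (X := X)) U

/-- A local system of rank 1 that is trivialized over the members of the cover `U`. -/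
abbrev RankOneLocalSystem {X : Type u} [TopologicalSpace X] {ι : Type u} (U : ι → Set X) : Type u :=
  RankOneCocycle (IsLocallyConstantAt (X := X)) U

/-- `φ = (φ_a)` is a 1-form with values in `L`: it equals `φ_a ⊗ e_a` over `U a`, the `φ_a` have the
property `Q` at the points of `U a`, and they fit together, `φ_a = g a b • φ_b`. -/
def IsTwistedOneForm {P : (X → ℂ) → X → Prop} {ι : Type u} {U : ι → Set X}
    (Q : OneForm n X → X → Prop) (L : RankOneCocycle P U) (φ : ι → OneForm n X) : Prop :=
  (∀ a, ∀ x ∈ U a, Q (φ a) x) ∧ ∀ a b, ∀ x ∈ U a ∩ U b, φ a x = L.g a b x • φ b x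

/-- `t = (t_a)` is an isomorphism (of line bundles or of local systems, according to `P`) from
`L₁ ⊗ ⋯ ⊗ Lₘ` to the trivial object, mapping the frame `e_{1,a} ⊗ ⋯ ⊗ e_{m,a}` over `U a` to the
nowhere zero function `t_a` of class `P`. -/
def IsTensorTrivialization {X : Type u} {P : (X → ℂ) → X → Prop} {ι : Type u} {U : ι → Set X}
    (L : Fin m → RankOneCocycle P U) (t : ι → X → ℂ) : Prop :=
  (∀ a, ∀ x ∈ U a, t a x ≠ 0 ∧ P (t a) x) ∧
    ∀ a b, ∀ x ∈ U a ∩ U b, t b x = (∏ k, (L k).g a b x) * t a x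

/-- `w = φ₁ ⋯ φₘ`, where the product, a section of `SᵐΩ¹ ⊗ (L₁ ⊗ ⋯ ⊗ Lₘ)`, is regarded as a section
of `SᵐΩ¹` through the isomorphism `t` from `L₁ ⊗ ⋯ ⊗ Lₘ` to the trivial object. -/
def IsTwistedProduct {ι : Type u} (U : ι → Set X) (w : TensorField n m X)
    (φ : Fin m → ι → OneForm n X) (t : ι → X → ℂ) : Prop :=
  ∀ a, ∀ x ∈ U a, w x = t a x • symProd (fun k => φ k a x)

/-- `U` is an open cover of `X`. -/
def IsOpenCover {X : Type u} [TopologicalSpace X] {ι : Type u} (U : ι → Set X) : Prop :=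
  (∀ a, IsOpen (U a)) ∧ ∀ x, ∃ a, x ∈ U a

/-- `w = φ₁ ⋯ φₘ` with closed holomorphic 1-forms `φₖ ∈ H⁰(X, Ω¹_cl ⊗ Lₖ)` twisted by local systems
`Lₖ` of rank 1 such that `L₁ ⊗ ⋯ ⊗ Lₘ ≃ ℂ`. (Finitely many local systems are always trivialized over
a common open cover.) -/
def HasTwistedClosedDecomposition (w : TensorField n m X) : Prop :=
  ∃ (ι : Type u) (U : ι → Set X), IsOpenCover U ∧
    ∃ (L : Fin m → RankOneLocalSystem U) (φ : Fin m → ι → OneForm n X) (t : ι → X → ℂ),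
      (∀ k, IsTwistedOneForm OneForm.IsClosedHolomorphicAt (L k) (φ k)) ∧
        IsTensorTrivialization L t ∧ IsTwistedProduct U w φ t

/-! ### Split symmetric differentials -/

/-- The 1-form `ψ`, whose values at its poles are irrelevant, is meromorphic near `x`: it is the
quotient of a holomorphic 1-form by a nonzero holomorphic function. -/
def OneForm.IsMeromorphicAt (ψ : OneForm n X) (x : X) : Prop :=
  ∃ (α : OneForm n X) (b : X → ℂ), α.IsHolomorphicAt x ∧ SymDiff.IsHolomorphicAt n b x ∧
    (∃ᶠ y in 𝓝 x, b y ≠ 0) ∧ ∀ᶠ y in 𝓝 x, b y ≠ 0 → ψ y = (b y)⁻¹ • α y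

/-- `w = ψ₁ ⋯ ψₘ` with meromorphic 1-forms `ψₖ` on `X`. -/
def IsMeromorphicallySplit (w : TensorField n m X) : Prop :=
  ∃ ψ : Fin m → OneForm n X, (∀ k x, (ψ k).IsMeromorphicAt x) ∧
    ∃ D : Set X, IsOpen D ∧ Dense D ∧ ∀ x ∈ D, w x = symProd (fun k => ψ k x)

/-- `w = μ₁ ⋯ μₘ` with `μₖ ∈ H⁰(X, Ω¹ ⊗ Lₖ)` for holomorphic line bundles `Lₖ`, whose tensor product
is trivialized so that the product of the `μₖ` is a section of `SᵐΩ¹`. -/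
def IsLineBundleSplit (w : TensorField n m X) : Prop :=
  ∃ (ι : Type u) (U : ι → Set X), IsOpenCover U ∧
    ∃ (L : Fin m → LineBundle n U) (μ : Fin m → ι → OneForm n X) (t : ι → X → ℂ),
      (∀ k, IsTwistedOneForm OneForm.IsHolomorphicAt (L k) (μ k)) ∧
        IsTensorTrivialization L t ∧ IsTwistedProduct U w μ t

/-- `w` is split, in either of the two usual senses. -/
def IsSplit (w : TensorField n m X) : Prop :=
  IsMeromorphicallySplit w ∨ IsLineBundleSplit w

/-- `f : X' → X` is a finite unramified cover of complex manifolds: a surjective covering map with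
finite fibres that is locally biholomorphic. -/
def IsFiniteUnramifiedCover (n : ℕ) {X' X : Type u} [TopologicalSpace X']
    [ChartedSpace (Fin n → ℂ) X'] [TopologicalSpace X] [ChartedSpace (Fin n → ℂ) X]
    (f : X' → X) : Prop :=
  IsCoveringMap f ∧ Function.Surjective f ∧ (∀ x, (f ⁻¹' {x}).Finite) ∧
    IsLocalDiffeomorph 𝓘(ℂ, Fin n → ℂ) 𝓘(ℂ, Fin n → ℂ) ω f

end Basic

end SymDiff

/-! The proof rests on a rigidity of closed decompositions. Let `w = ∏ aᵢ = ∏ bᵢ` with closed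
factors, near a point where no factor vanishes and `b` has no abelian relation. Evaluation on the
diagonal shows that every `bᵢ` is pointwise parallel to some `aⱼ`, so after a permutation `aᵢ = gᵢ
bᵢ` with `∏ gᵢ = 1`. Since `aᵢ` and `bᵢ` are closed, `dgᵢ ∧ bᵢ = 0`, hence `dgᵢ / gᵢ = fᵢ bᵢ` for a
holomorphic `fᵢ`. The left side is closed, so `dfᵢ ∧ bᵢ = 0`, and `∑ fᵢ bᵢ` is the logarithmic
derivative of `∏ gᵢ = 1`, which is zero. Thus `(fᵢ)` is an abelian relation; it vanishes, and every
`gᵢ` is constant (`eventually_eq_const_smul`).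

Trivial rank also excludes zero factors and pairs of parallel factors, so the permutation is unique.
The identity theorem carries these facts from general points to all points: two closed
decompositions at any point agree up to a unique permutation and constants of product 1
(`HasTrivialAbelianRank.exists_perm`, `perm_eq`, `prod_eq_one`).

Consequently the orderings of the local factors form a finite covering of `X`, over which the
factors are tautologically labelled (`HasTrivialAbelianRank.exists_labelled_covering`); a connected
component of it still covers a connected `X`. Once the factors are labelled consistently, the
constants between local decompositions are cocycles of rank 1 local systems with trivial tensor
product (`HasTrivialAbelianRank.hasTwistedClosedDecomposition_pullback`). If `w` is split, the
global factors already label the closed ones on `X` up to scalar functions, and no cover is needed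
(`HasTrivialAbelianRank.hasTwistedClosedDecomposition_of_label`). -/

namespace SymDiff

/-! ### Products of linear forms and uniqueness of their factors up to scalars. -/

section LinearForms

variable {V : Type*} [AddCommGroup V] [Module ℂ V] [TopologicalSpace V] {m : ℕ}

/-- Two linear forms are parallel if `α ∧ β = 0`. -/
def Parallel (α β : V →L[ℂ] ℂ) : Prop :=
  ∀ u v, α u * β v = α v * β u

theorem Parallel.symm {α β : V →L[ℂ] ℂ} (h : Parallel α β) : Parallel β α := fun u v => by
  linear_combination -h u v

theorem Parallel.refl (α : V →L[ℂ] ℂ) : Parallel α α := fun _ _ => mul_comm _ _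

theorem parallel_of_ker {α β : V →L[ℂ] ℂ} (h : ∀ v, β v = 0 → α v = 0) : Parallel α β := by
  intro u v
  -- This combination lies in the kernel of `β`.
  have := h (β v • u - β u • v) (by simp; ring)
  simp at this
  linear_combination this

theorem Parallel.eq_smul {α β : V →L[ℂ] ℂ} (h : Parallel α β) {v : V} (hv : β v ≠ 0) :
    α = (α v / β v) • β := by
  ext u
  have := h u v
  simp
  field_simp
  linear_combination this

theorem Parallel.smul_left (c : ℂ) {α β : V →L[ℂ] ℂ} (h : Parallel α β) : Parallel (c • α) β :=
  fun u v => by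
    have := h u v
    simp
    linear_combination c * this

theorem Parallel.trans {α β γ : V →L[ℂ] ℂ} (h : Parallel α β) (h' : Parallel β γ) (hβ : β ≠ 0) :
    Parallel α γ := by
  obtain ⟨v, hv⟩ := DFunLike.ne_iff.mp hβ
  rw [h.eq_smul hv]
  exact h'.smul_left _

/-- A vector space over an infinite field is not a finite union of proper subspaces, here the
kernels. -/
theorem exists_forall_apply_ne_zero (α : Fin m → V →L[ℂ] ℂ) (h : ∀ i, α i ≠ 0) :
    ∃ v, ∀ i, α i v ≠ 0 :=
  Module.Dual.exists_forall_ne_zero_of_forall_exists (fun i => (α i : V →ₗ[ℂ] ℂ))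
    fun i => DFunLike.ne_iff.mp (h i)

/-- A form not parallel to `β` is nonzero on `ker β`. If this held for all `α i`, a vector of `ker
β` would avoid all their kernels. This replaces unique factorization of polynomials. -/
theorem exists_parallel {α : Fin m → V →L[ℂ] ℂ} {β : V →L[ℂ] ℂ}
    (h : ∀ v, β v = 0 → ∏ i, α i v = 0) : ∃ i, Parallel (α i) β := by
  by_contra! hc
  have h1 : ∀ i, ∃ v ∈ LinearMap.ker (β : V →ₗ[ℂ] ℂ), (α i : V →ₗ[ℂ] ℂ) v ≠ 0 := by
    intro i
    by_contra! h2
    exact hc i (parallel_of_ker fun v hv => h2 v hv)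
  obtain ⟨v, hv, hv'⟩ := Module.Dual.exists_forall_mem_ne_zero_of_forall_exists _ _ h1
  exact Finset.prod_ne_zero_iff.mpr (fun i _ => hv' i) (h v hv)

/-- If the products of two families of linear forms agree up to a scalar, every factor of the
second one is parallel to a factor of the first one. -/
theorem exists_parallel_of_prod_eq {α β : Fin m → V →L[ℂ] ℂ} {c : ℂ}
    (h : ∀ v, ∏ i, α i v = c * ∏ i, β i v) (i : Fin m) : ∃ j, Parallel (α j) (β i) :=
  exists_parallel fun v hv => by
    rw [h, Finset.prod_eq_zero (Finset.mem_univ i) hv, mul_zero]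

/-- Pairwise independence of the factors depends on the product only. -/
theorem pairwise_not_parallel_of_prod_eq {α β : Fin m → V →L[ℂ] ℂ}
    (h : ∀ v, ∏ i, α i v = ∏ i, β i v) (hβ : ∀ i, β i ≠ 0)
    (hp : ∀ i j, i ≠ j → ¬ Parallel (α i) (α j)) :
    ∀ i j, i ≠ j → ¬ Parallel (β i) (β j) := by
  choose σ hσ using exists_parallel_of_prod_eq (α := α) (β := β) (c := 1) (by simpa using h)
  choose τ hτ using exists_parallel_of_prod_eq (α := β) (β := α) (c := 1)
    (by simpa using fun v => (h v).symm)
  -- `α (σ (τ i))` is parallel to `β (τ i)`, hence to `α i`, which forces `σ (τ i) = i`.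
  have hsurj : Function.Surjective σ := fun i => ⟨τ i, by
    by_contra hne
    exact hp _ _ hne ((hσ (τ i)).trans (hτ i) (hβ _))⟩
  have hinj := Finite.injective_iff_surjective.mpr hsurj
  intro i j hij hpar
  exact hp _ _ (fun h => hij (hinj h))
    (((hσ i).trans hpar (hβ _)).trans (hσ j).symm (hβ _))

end LinearForms

section SymProd

variable {n m : ℕ} {X : Type u} [TopologicalSpace X] [ChartedSpace (Fin n → ℂ) X]

/-- All `m!` permutations contribute the same product, which cancels the normalization.
Decompositions are compared only through these diagonal values. -/
theorem symProd_diag {x : X} (α : Fin m → TangentSpace 𝓘(ℂ, Fin n → ℂ) x →L[ℂ] ℂ)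
    (v : TangentSpace 𝓘(ℂ, Fin n → ℂ) x) :
    symProd α (fun _ => v) = ∏ i, α i v := by
  have h : ∀ σ : Equiv.Perm (Fin m), ∏ i, α (σ i) v = ∏ i, α i v := fun σ =>
    Equiv.prod_comp σ (fun i => α i v)
  simp only [symProd, smul_apply, sum_apply,
    ContinuousMultilinearMap.compContinuousLinearMap_apply,
    ContinuousMultilinearMap.mkPiAlgebra_apply, h]
  simp [Fintype.card_perm, Nat.factorial_ne_zero]

theorem symProd_perm {x : X} (α : Fin m → TangentSpace 𝓘(ℂ, Fin n → ℂ) x →L[ℂ] ℂ)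
    (τ : Equiv.Perm (Fin m)) : symProd (fun i => α (τ i)) = symProd α := by
  unfold symProd
  congr 1
  exact Fintype.sum_equiv (Equiv.mulLeft τ) _ _ fun σ => rfl

end SymProd

end SymDiff

namespace SymDiff

/-! ### Generic points near a given point. -/

section Generic

variable {X : Type u} [TopologicalSpace X]

/-- The filter of the sets whose interior is dense in a neighbourhood of `x`. -/
def generically (x : X) : Filter X where
  sets := {S | ∀ᶠ y in 𝓝 x, y ∈ closure (interior S)}
  univ_sets := by simp
  sets_of_superset {S T} hS hST :=
    hS.mono fun y hy => closure_mono (interior_mono hST) hy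
  inter_sets {S T} hS hT := by
    have hT' := eventually_eventually_nhds.mpr hT
    filter_upwards [hS, hT'] with y hyS hyT
    rw [mem_closure_iff_nhds] at hyS ⊢
    intro N hN
    -- Inside `O`, where `interior T` is dense, there is a point of `interior S`, and close to it a
    -- point of both interiors.
    obtain ⟨O, hOT, hO, hyO⟩ := mem_nhds_iff.mp (Filter.inter_mem hyT hN)
    obtain ⟨z, hz, hzS⟩ := hyS O (hO.mem_nhds hyO)
    have hzT : z ∈ closure (interior T) := (hOT hz).1
    rw [mem_closure_iff_nhds] at hzT
    obtain ⟨p, hp, hpT⟩ := hzT (O ∩ interior S) ((hO.inter isOpen_interior).mem_nhds ⟨hz, hzS⟩)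
    exact ⟨p, (hOT hp.1).2, by rw [interior_inter]; exact ⟨hp.2, hpT⟩⟩

theorem eventually_generically_iff {x : X} {P : X → Prop} :
    (∀ᶠ y in generically x, P y) ↔ ∀ᶠ y in 𝓝 x, y ∈ closure (interior {z | P z}) :=
  Iff.rfl

theorem generically_le_nhds (x : X) : generically x ≤ 𝓝 x := fun _ hS =>
  (eventually_eventually_nhds.mpr hS).mono fun _ hy =>
    subset_closure (mem_interior_iff_mem_nhds.mpr hy)

/-- This is what lets finitely many generic conditions be realized at a common point, the standard
move in the sequel. -/
instance generically_neBot (x : X) : (generically x).NeBot := by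
  refine ⟨fun h => ?_⟩
  have h1 : (∅ : Set X) ∈ generically x := by rw [h]; trivial
  have h2 : ∀ᶠ y in 𝓝 x, y ∈ closure (interior (∅ : Set X)) := h1
  simpa using h2.self_of_nhds

theorem eventually_eventually_generically {x : X} {P : X → Prop}
    (h : ∀ᶠ y in generically x, P y) : ∀ᶠ y in 𝓝 x, ∀ᶠ z in generically y, P z :=
  eventually_eventually_nhds.mpr (eventually_generically_iff.mp h)

theorem eventually_generically_of_dense {D : Set X} (hD : IsOpen D) (hd : Dense D) (x : X) :
    ∀ᶠ y in generically x, y ∈ D := by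
  rw [eventually_generically_iff]
  refine Filter.Eventually.of_forall fun y => ?_
  have : {z | z ∈ D} = D := rfl
  rw [this, hD.interior_eq]
  exact hd y

end Generic

/-! ### Analytic functions in charts and the identity theorem. -/

section ChartAnalytic

variable {n : ℕ} {X : Type u} [TopologicalSpace X] [ChartedSpace (Fin n → ℂ) X]
variable {E : Type*} [NormedAddCommGroup E] [NormedSpace ℂ E]

/-- The vector valued function `F` is analytic at `x` in the preferred chart at `x`. -/
def ChartAnalyticAt (n : ℕ) {X : Type u} [TopologicalSpace X] [ChartedSpace (Fin n → ℂ) X]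
    (F : X → E) (x : X) : Prop :=
  AnalyticAt ℂ (F ∘ (chartAt (Fin n → ℂ) x).symm) (chartAt (Fin n → ℂ) x x)

theorem eventually_nhds_iff_chart (n : ℕ) {X : Type u} [TopologicalSpace X]
    [ChartedSpace (Fin n → ℂ) X] {x : X} {P : X → Prop} :
    (∀ᶠ y in 𝓝 x, P y) ↔
      ∀ᶠ z in 𝓝 (chartAt (Fin n → ℂ) x x), P ((chartAt (Fin n → ℂ) x).symm z) := by
  have h := (chartAt (Fin n → ℂ) x).symm.map_nhds_eq
    (x := chartAt (Fin n → ℂ) x x) (by simp)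
  rw [(chartAt (Fin n → ℂ) x).left_inv (mem_chart_source _ x)] at h
  rw [← h, Filter.eventually_map]

theorem chartAnalyticAt_of_isHolomorphicAt {f : X → ℂ} {x : X} (h : IsHolomorphicAt n f x) :
    ChartAnalyticAt n f x := by
  have h2 := (contMDiffAt_iff.mp h).2
  simp only [extChartAt, mfld_simps,
    modelWithCornersSelf_coe, Set.range_id, contDiffWithinAt_univ] at h2
  have h3 : ContDiffAt ℂ ω (f ∘ (chartAt (Fin n → ℂ) x).symm) (chartAt (Fin n → ℂ) x x) := h2
  exact h3.analyticAt

theorem ChartAnalyticAt.eventually_continuousAt [CompleteSpace E] {F : X → E} {x : X}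
    (h : ChartAnalyticAt n F x) :
    ∀ᶠ y in 𝓝 x, ContinuousAt F y := by
  have h1 := h.eventually_analyticAt
  have h2 : ∀ᶠ y in 𝓝 x, y ∈ (chartAt (Fin n → ℂ) x).source :=
    (chartAt (Fin n → ℂ) x).open_source.mem_nhds (mem_chart_source _ x)
  have h3 := ((chartAt (Fin n → ℂ) x).continuousAt (mem_chart_source _ x)).eventually h1
  filter_upwards [h2, h3] with y hy hy'
  have h4 : ContinuousAt ((F ∘ (chartAt (Fin n → ℂ) x).symm) ∘ (chartAt (Fin n → ℂ) x)) y :=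
    hy'.continuousAt.comp ((chartAt (Fin n → ℂ) x).continuousAt hy)
  refine h4.congr ?_
  filter_upwards [(chartAt (Fin n → ℂ) x).open_source.mem_nhds hy] with z hz
  simp [(chartAt (Fin n → ℂ) x).left_inv hz]

/-- The identity theorem: near `x`, a linear relation with constant coefficient between two analytic
functions propagates. -/
theorem ChartAnalyticAt.propagate [CompleteSpace E] {F G : X → E} {x : X}
    (hF : ChartAnalyticAt n F x) (hG : ChartAnalyticAt n G x) :
    ∀ᶠ y in 𝓝 x, ∀ c : ℂ, (∀ᶠ z in 𝓝 y, F z = c • G z) → ∀ᶠ z in 𝓝 x, F z = c • G z := by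
  set φ := chartAt (Fin n → ℂ) x
  have h1 : ∀ᶠ z in 𝓝 (φ x), z ∈ φ.target ∧ AnalyticAt ℂ (F ∘ φ.symm) z ∧
      AnalyticAt ℂ (G ∘ φ.symm) z :=
    Filter.Eventually.and (φ.open_target.mem_nhds (mem_chart_target _ x))
      (hF.eventually_analyticAt.and hG.eventually_analyticAt)
  -- The ball is fixed before `c`, so one neighbourhood serves all constants.
  obtain ⟨r, hr, hball⟩ := Metric.eventually_nhds_iff_ball.mp h1
  rw [eventually_nhds_iff_chart n]
  filter_upwards [Metric.ball_mem_nhds _ hr] with z hz c hc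
  rw [eventually_nhds_iff_chart n]
  have hd : AnalyticOnNhd ℂ (fun z => F (φ.symm z) - c • G (φ.symm z)) (Metric.ball (φ x) r) :=
    fun z hz => (hball z hz).2.1.sub ((hball z hz).2.2.const_smul (c := c))
  have h0 := hd.eqOn_zero_of_preconnected_of_eventuallyEq_zero
    (convex_ball _ _).isPreconnected hz ?_
  · filter_upwards [Metric.ball_mem_nhds _ hr] with z hz
    exact sub_eq_zero.mp (h0 hz)
  · have := (φ.symm.continuousAt (x := z) (hball z hz).1).eventually hc
    filter_upwards [this] with y hy
    simp [hy]

/-- If nonvanishing is not generic, `F` vanishes on an open set arbitrarily close to `x`, and the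
identity theorem with constant `0` spreads this to a neighbourhood of `x`. -/
theorem ChartAnalyticAt.eventually_eq_zero_or_generically_ne_zero [CompleteSpace E] {F : X → E}
    {x : X} (hF : ChartAnalyticAt n F x) :
    (∀ᶠ y in 𝓝 x, F y = 0) ∨ ∀ᶠ y in generically x, F y ≠ 0 := by
  by_contra h
  obtain ⟨h1, h2⟩ := not_or.mp h
  apply h1
  have h3 := hF.propagate hF
  have h4 := hF.eventually_continuousAt
  rw [eventually_generically_iff, Filter.not_eventually] at h2
  obtain ⟨y, hy, hy3, hy4⟩ := (Filter.Frequently.and_eventually h2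
    (h3.and (eventually_eventually_nhds.mpr h4))).exists
  have h5 : ∀ᶠ z in 𝓝 y, F z = (0 : ℂ) • F z := by
    rw [mem_closure_iff_nhds] at hy
    push Not at hy
    obtain ⟨N, hN, hN'⟩ := hy
    filter_upwards [hN, hy4] with z hz hc
    rw [zero_smul]
    by_contra hne
    have : z ∈ interior {z | F z ≠ 0} := mem_interior_iff_mem_nhds.mpr (hc.eventually_ne hne)
    exact Set.eq_empty_iff_forall_notMem.mp hN' z ⟨hz, this⟩
  simpa using hy3 0 h5

end ChartAnalytic

end SymDiff

namespace SymDiff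

/-! ### Local rigidity of closed decompositions on a vector space. -/

section Model

variable {W : Type*} [NormedAddCommGroup W] [NormedSpace ℂ W] {m : ℕ}

/-- The differential of the 1-form `a` vanishes near `p`. -/
def ClosedNear (a : W → W →L[ℂ] ℂ) (p : W) : Prop :=
  ∀ᶠ z in 𝓝 p, ∀ u v, fderiv ℂ a z u v = fderiv ℂ a z v u

/-- There is no nonzero holomorphic abelian relation between the 1-forms `b i` at `p`. -/
def NoHolomorphicRelation (b : Fin m → W → W →L[ℂ] ℂ) (p : W) : Prop :=
  ∀ f : Fin m → W → ℂ, (∀ i, AnalyticAt ℂ (f i) p) →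
    (∀ᶠ z in 𝓝 p, ∑ i, f i z • b i z = 0) →
    (∀ i, ∀ᶠ z in 𝓝 p, ∀ u v, fderiv ℂ (f i) z u * b i z v = fderiv ℂ (f i) z v * b i z u) →
    ∀ i, ∀ᶠ z in 𝓝 p, f i z = 0

/-- If `a = g b` with closed 1-forms `a` and `b`, then `dg ∧ b = 0`. -/
theorem fderiv_parallel {a b : W → W →L[ℂ] ℂ} {g : W → ℂ} {z : W}
    (h : ∀ᶠ y in 𝓝 z, a y = g y • b y) (hg : DifferentiableAt ℂ g z)
    (hb : DifferentiableAt ℂ b z)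
    (ha' : ∀ u v, fderiv ℂ a z u v = fderiv ℂ a z v u)
    (hb' : ∀ u v, fderiv ℂ b z u v = fderiv ℂ b z v u) (u v : W) :
    fderiv ℂ g z u * b z v = fderiv ℂ g z v * b z u := by
  have h1 : fderiv ℂ a z = fderiv ℂ (fun y => g y • b y) z := Filter.EventuallyEq.fderiv_eq h
  have h2 := ha' u v
  rw [h1, fderiv_fun_smul hg hb] at h2
  simp at h2
  linear_combination h2 - g z * hb' u v

/-- The logarithmic derivative of an analytic function is closed. -/
theorem fderiv_inv_smul_fderiv_symm [CompleteSpace W] {g : W → ℂ} {z : W}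
    (hg : AnalyticAt ℂ g z) (h0 : g z ≠ 0)
    (u v : W) : fderiv ℂ (fun y => (g y)⁻¹ • fderiv ℂ g y) z u v =
      fderiv ℂ (fun y => (g y)⁻¹ • fderiv ℂ g y) z v u := by
  have h1 : DifferentiableAt ℂ (fun y => (g y)⁻¹) z := (hg.inv h0).differentiableAt
  have h2 : DifferentiableAt ℂ (fderiv ℂ g) z := hg.fderiv.differentiableAt
  have h3 : IsSymmSndFDerivAt ℂ g z := hg.contDiffAt.isSymmSndFDerivAt (n := ω) (by simp)
  have h4 : fderiv ℂ (fun y => (g y)⁻¹) z = -((g z) ^ 2)⁻¹ • fderiv ℂ g z :=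
    ((hasDerivAt_inv h0).comp_hasFDerivAt z hg.differentiableAt.hasFDerivAt).fderiv
  rw [fderiv_fun_smul h1 h2, h4]
  have := h3 u v
  simp [this]
  ring

theorem eventually_eq_const_of_fderiv_eq_zero {g : W → ℂ} {p : W}
    (hg : ∀ᶠ z in 𝓝 p, DifferentiableAt ℂ g z) (h : ∀ᶠ z in 𝓝 p, fderiv ℂ g z = 0) :
    ∀ᶠ z in 𝓝 p, g z = g p := by
  obtain ⟨r, hr, hball⟩ := Metric.eventually_nhds_iff_ball.mp (hg.and h)
  filter_upwards [Metric.ball_mem_nhds p hr] with z hz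
  exact Metric.isOpen_ball.is_const_of_fderiv_eq_zero (convex_ball p r).isPreconnected
    (fun y hy => (hball y hy).1.differentiableWithinAt) (fun y hy => (hball y hy).2) hz
    (Metric.mem_ball_self hr)

/-- If `a` and `b` are closed decompositions with parallel factors and `b` has no abelian relations,
then the factors differ by constants. -/
theorem eventually_eq_const_smul [CompleteSpace W] {a b : Fin m → W → W →L[ℂ] ℂ} {p v : W}
    (ha : ∀ i, AnalyticAt ℂ (a i) p) (hb : ∀ i, AnalyticAt ℂ (b i) p)
    (hac : ∀ i, ClosedNear (a i) p) (hbc : ∀ i, ClosedNear (b i) p)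
    (hv : ∀ i, b i p v ≠ 0) (hpar : ∀ i, ∀ᶠ z in 𝓝 p, Parallel (a i z) (b i z))
    (hprod : ∀ᶠ z in 𝓝 p, ∏ i, a i z v = ∏ i, b i z v)
    (hrel : NoHolomorphicRelation b p) :
    ∀ i, ∃ c : ℂ, ∀ᶠ z in 𝓝 p, a i z = c • b i z := by
  have hav : ∀ i, AnalyticAt ℂ (fun z => a i z v) p := fun i =>
    ((ContinuousLinearMap.apply ℂ ℂ v).analyticAt _).comp (ha i)
  have hbv : ∀ i, AnalyticAt ℂ (fun z => b i z v) p := fun i =>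
    ((ContinuousLinearMap.apply ℂ ℂ v).analyticAt _).comp (hb i)
  have hbv0 : ∀ i, ∀ᶠ z in 𝓝 p, b i z v ≠ 0 := fun i => (hbv i).continuousAt.eventually_ne (hv i)
  set g : Fin m → W → ℂ := fun i z => a i z v / b i z v with hgdef
  have hg : ∀ i, AnalyticAt ℂ (g i) p := fun i => (hav i).div (hbv i) (hv i)
  have hab : ∀ i, ∀ᶠ z in 𝓝 p, a i z = g i z • b i z := fun i => by
    filter_upwards [hbv0 i, hpar i] with z h0 h1
    exact h1.eq_smul h0
  have hgprod : ∀ᶠ z in 𝓝 p, ∏ i, g i z = 1 := by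
    filter_upwards [hprod, Filter.eventually_all.mpr hbv0] with z h1 h2
    rw [hgdef, Finset.prod_div_distrib, h1, div_self]
    exact Finset.prod_ne_zero_iff.mpr fun i _ => h2 i
  have hg0 : ∀ᶠ z in 𝓝 p, ∀ i, g i z ≠ 0 := by
    filter_upwards [hgprod] with z hz i h0
    rw [Finset.prod_eq_zero (Finset.mem_univ i) h0] at hz
    exact zero_ne_one hz
  have hdg : ∀ i, ∀ᶠ z in 𝓝 p, ∀ u, fderiv ℂ (g i) z u * b i z v =
      fderiv ℂ (g i) z v * b i z u := fun i => by
    filter_upwards [eventually_eventually_nhds.mpr (hab i), (hg i).eventually_analyticAt,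
      (hb i).eventually_analyticAt, hac i, hbc i] with z h1 h2 h3 h4 h5 u
    exact fderiv_parallel h1 h2.differentiableAt h3.differentiableAt h4 h5 u v
  -- As `dgᵢ` is parallel to `bᵢ`, so is `dgᵢ / gᵢ`; its coefficient is read off by evaluating at
  -- `v`. These `f i` are the candidate abelian relation.
  set f : Fin m → W → ℂ := fun i z => fderiv ℂ (g i) z v / (g i z * b i z v)
  have hf : ∀ i, AnalyticAt ℂ (f i) p := fun i =>
    (((ContinuousLinearMap.apply ℂ ℂ v).analyticAt _).comp (hg i).fderiv).div
      ((hg i).mul (hbv i)) (mul_ne_zero (hg0.self_of_nhds i) (hv i))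
  have hfb : ∀ i, ∀ᶠ z in 𝓝 p, (g i z)⁻¹ • fderiv ℂ (g i) z = f i z • b i z := fun i => by
    filter_upwards [hbv0 i, hg0, hdg i] with z h1 h2 h3
    ext u
    have h4 := h3 u
    have h5 := h2 i
    simp only [smul_apply, smul_eq_mul, f]
    field_simp
    linear_combination h4
  have hf0 := hrel f hf ?_ ?_
  · intro i
    refine ⟨g i p, ?_⟩
    have h1 : ∀ᶠ z in 𝓝 p, fderiv ℂ (g i) z = 0 := by
      filter_upwards [hf0 i, hfb i, hg0] with z h1 h2 h3
      rw [h1, zero_smul ℂ (b i z)] at h2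
      exact (smul_eq_zero_iff_right (inv_ne_zero (h3 i))).mp h2
    have h2 := eventually_eq_const_of_fderiv_eq_zero
      ((hg i).eventually_analyticAt.mono fun z h => h.differentiableAt) h1
    filter_upwards [hab i, h2] with z h3 h4
    rw [h3, h4]
  -- `∑ fᵢ bᵢ = ∑ dgᵢ / gᵢ`, and the product rule identifies this with `d(∏ gᵢ) = 0`, because `∏ gᵢ
  -- = 1` turns each cofactor of `gᵢ` into its inverse.
  · filter_upwards [Filter.eventually_all.mpr hfb, eventually_eventually_nhds.mpr hgprod, hg0,
      Filter.eventually_all.mpr fun i => (hg i).eventually_analyticAt] with z h1 h2 h3 h4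
    simp only [← h1]
    have h5 := HasFDerivAt.finsetProd (u := Finset.univ) (g := g) (x := z)
      (fun i _ => (h4 i).differentiableAt.hasFDerivAt)
    have h6 : fderiv ℂ (fun y => ∏ i, g i y) z = 0 := by
      have : (fun y => ∏ i, g i y) =ᶠ[𝓝 z] fun _ => 1 := h2
      rw [this.fderiv_eq]; simp
    rw [h5.fderiv] at h6
    rw [← h6]
    refine Finset.sum_congr rfl fun i _ => ?_
    congr 1
    have h7 := Finset.mul_prod_erase Finset.univ (fun i => g i z) (Finset.mem_univ i)
    rw [h2.self_of_nhds] at h7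
    exact (eq_inv_of_mul_eq_one_right h7).symm
  · intro i
    -- Both `dgᵢ / gᵢ = fᵢ bᵢ` and `bᵢ` are closed, so `dfᵢ ∧ bᵢ = 0`.
    filter_upwards [eventually_eventually_nhds.mpr (hfb i), (hf i).eventually_analyticAt,
      (hb i).eventually_analyticAt, hbc i, (hg i).eventually_analyticAt, hg0]
      with z h1 h2 h3 h4 h5 h6 u v
    exact fderiv_parallel h1 h2.differentiableAt h3.differentiableAt
      (fderiv_inv_smul_fderiv_symm h5 (h6 i)) h4 u v

/-- Closed 1-forms without abelian relations are pairwise non-parallel. -/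
theorem not_eventually_parallel [CompleteSpace W] {b : Fin m → W → W →L[ℂ] ℂ} {p v : W}
    (hb : ∀ i, AnalyticAt ℂ (b i) p) (hbc : ∀ i, ClosedNear (b i) p) (hv : ∀ i, b i p v ≠ 0)
    (hrel : NoHolomorphicRelation b p) {i j : Fin m} (hij : i ≠ j) :
    ¬ ∀ᶠ z in 𝓝 p, Parallel (b i z) (b j z) := by
  intro hpar
  have hbv : ∀ i, AnalyticAt ℂ (fun z => b i z v) p := fun i =>
    ((ContinuousLinearMap.apply ℂ ℂ v).analyticAt _).comp (hb i)
  set g : W → ℂ := fun z => b i z v / b j z v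
  have hg : AnalyticAt ℂ g p := (hbv i).div (hbv j) (hv j)
  have hab : ∀ᶠ z in 𝓝 p, b i z = g z • b j z := by
    filter_upwards [(hbv j).continuousAt.eventually_ne (hv j), hpar] with z h0 h1
    exact h1.eq_smul h0
  -- The abelian relation `1 · bᵢ - g · bⱼ = 0`, nonzero because of its constant coefficient.
  have h := hrel (fun k => if k = i then fun _ => 1 else if k = j then fun z => - g z else
    fun _ => 0) ?_ ?_ ?_ i
  · simpa using h.self_of_nhds
  · intro k
    split_ifs
    exacts [analyticAt_const, hg.neg, analyticAt_const]
  · filter_upwards [hab] with z hz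
    rw [Finset.sum_eq_add i j hij]
    · ext u
      simp [hij.symm, hz]
    · intro k _ hk
      simp [hk.1, hk.2, zero_smul ℂ (b k z)]
    · simp
    · simp
  · intro k
    split_ifs with h1 h2
    · simp
    · subst h2
      filter_upwards [eventually_eventually_nhds.mpr hab, hg.eventually_analyticAt,
        (hb k).eventually_analyticAt, hbc i, hbc k] with z h1 h2 h3 h4 h5 u v
      have h6 := fderiv_parallel h1 h2.differentiableAt h3.differentiableAt h4 h5 u v
      rw [fderiv_fun_neg]
      simp [h6]
    · simp

/-- A zero factor could be given the coefficient `1` and all others `0`. -/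
theorem not_eventually_eq_zero {b : Fin m → W → W →L[ℂ] ℂ} {p : W}
    (hrel : NoHolomorphicRelation b p) (i : Fin m) : ¬ ∀ᶠ z in 𝓝 p, b i z = 0 := by
  intro h0
  have h := hrel (fun k => if k = i then fun _ => 1 else fun _ => 0) ?_ ?_ ?_ i
  · simpa using h.self_of_nhds
  · intro k
    split_ifs <;> exact analyticAt_const
  · filter_upwards [h0] with z hz
    refine Finset.sum_eq_zero fun k _ => ?_
    by_cases hk : k = i
    · simp [hk, hz]
    · simp [hk, zero_smul ℂ (b k z)]
  · intro k
    split_ifs <;> simp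

end Model

end SymDiff

namespace SymDiff

/-! ### Pullback of 1-forms and passage between manifold and charts. -/

section Pullback

variable {n : ℕ} {X Y Z : Type*} [TopologicalSpace X] [ChartedSpace (Fin n → ℂ) X]
  [TopologicalSpace Y] [ChartedSpace (Fin n → ℂ) Y] [TopologicalSpace Z]
  [ChartedSpace (Fin n → ℂ) Z]

/-- The pullback of a 1-form under a map. -/
noncomputable def OneForm.pullback (h : Y → X) (μ : OneForm n X) : OneForm n Y :=
  fun y => (μ (h y)).comp (mfderiv 𝓘(ℂ, Fin n → ℂ) 𝓘(ℂ, Fin n → ℂ) h y)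

theorem OneForm.pullback_congr (μ : OneForm n X) {h h' : Y → X} {y : Y} (hh : h =ᶠ[𝓝 y] h') :
    μ.pullback h y = μ.pullback h' y := by
  have h1 : (mfderiv 𝓘(ℂ, Fin n → ℂ) 𝓘(ℂ, Fin n → ℂ) h y : (Fin n → ℂ) →L[ℂ] (Fin n → ℂ)) =
    mfderiv 𝓘(ℂ, Fin n → ℂ) 𝓘(ℂ, Fin n → ℂ) h' y := hh.mfderiv_eq
  -- The tangent spaces at `h y` and `h' y` are both `Fin n → ℂ` by definition, which makes the two
  -- values comparable.
  have h3 : ∀ a b : X, a = b → (μ a : (Fin n → ℂ) →L[ℂ] ℂ) = μ b := by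
    rintro a _ rfl
    rfl
  have h2 := h3 _ _ hh.eq_of_nhds
  exact congrArg₂ (fun (a : (Fin n → ℂ) →L[ℂ] ℂ) (b : (Fin n → ℂ) →L[ℂ] (Fin n → ℂ)) => a.comp b)
    h2 h1

theorem OneForm.pullback_comp (μ : OneForm n X) {h : Y → X} {k : Z → Y} {z : Z}
    (hh : MDifferentiableAt 𝓘(ℂ, Fin n → ℂ) 𝓘(ℂ, Fin n → ℂ) h (k z))
    (hk : MDifferentiableAt 𝓘(ℂ, Fin n → ℂ) 𝓘(ℂ, Fin n → ℂ) k z) :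
    μ.pullback (h ∘ k) z = (μ.pullback h).pullback k z := by
  unfold OneForm.pullback
  rw [mfderiv_comp z hh hk]
  rfl

end Pullback

section Coord

variable {n m : ℕ} {X : Type u} [TopologicalSpace X] [ChartedSpace (Fin n → ℂ) X]

theorem OneForm.coord_eq_pullback (μ : OneForm n X) (x : X) :
    μ.coord x = μ.pullback (chartAt (Fin n → ℂ) x).symm := rfl

theorem OneForm.IsHolomorphicAt.chartAnalyticAt {μ : OneForm n X} {x : X}
    (h : μ.IsHolomorphicAt x) :
    ChartAnalyticAt n (fun y => μ.coord x (chartAt (Fin n → ℂ) x y)) x := by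
  refine AnalyticAt.congr h ?_
  filter_upwards [(chartAt (Fin n → ℂ) x).open_target.mem_nhds (mem_chart_target _ x)] with z hz
  simp [(chartAt (Fin n → ℂ) x).right_inv hz]

variable [IsManifold 𝓘(ℂ, Fin n → ℂ) ω X]

theorem mdifferentiable_chartAt (x : X) : (chartAt (Fin n → ℂ) x).MDifferentiable
    𝓘(ℂ, Fin n → ℂ) 𝓘(ℂ, Fin n → ℂ) :=
  have : IsManifold 𝓘(ℂ, Fin n → ℂ) 1 X := .of_le (n := ω) le_top
  mdifferentiable_chart x

/-- At a point of the chart domain, all 1-forms are expressed in the chart through the same linear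
isomorphism. -/
theorem exists_coord_eq_comp {x y : X} (hy : y ∈ (chartAt (Fin n → ℂ) x).source) :
    ∃ A : (Fin n → ℂ) →L[ℂ] TangentSpace 𝓘(ℂ, Fin n → ℂ) y, Function.Surjective A ∧
      ∀ μ : OneForm n X, μ.coord x (chartAt (Fin n → ℂ) x y) = (μ y).comp A := by
  obtain ⟨z, hz, rfl⟩ : ∃ z ∈ (chartAt (Fin n → ℂ) x).target, (chartAt (Fin n → ℂ) x).symm z = y :=
    ⟨_, (chartAt (Fin n → ℂ) x).map_source hy, (chartAt (Fin n → ℂ) x).left_inv hy⟩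
  rw [(chartAt (Fin n → ℂ) x).right_inv hz]
  exact ⟨_, (mdifferentiable_chartAt x).symm.mfderiv_surjective hz, fun μ => rfl⟩

theorem OneForm.coord_change (μ : OneForm n X) {x y : X} {z : Fin n → ℂ}
    (hz : z ∈ (chartAt (Fin n → ℂ) x).target)
    (hzy : (chartAt (Fin n → ℂ) x).symm z ∈ (chartAt (Fin n → ℂ) y).source) :
    μ.coord x z = (μ.coord y (chartAt (Fin n → ℂ) y ((chartAt (Fin n → ℂ) x).symm z))).comp
      (fderiv ℂ (chartAt (Fin n → ℂ) y ∘ (chartAt (Fin n → ℂ) x).symm) z) := by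
  set φ := chartAt (Fin n → ℂ) x
  set ψ := chartAt (Fin n → ℂ) y
  have hev : φ.symm =ᶠ[𝓝 z] ψ.symm ∘ (ψ ∘ φ.symm) := by
    filter_upwards [(φ.symm.continuousAt (x := z) hz).eventually (ψ.open_source.mem_nhds hzy)]
      with z' hz'
    exact (ψ.left_inv hz').symm
  have h1 := (mdifferentiable_chartAt x).mdifferentiableAt_symm hz
  have h2 := (mdifferentiable_chartAt y).mdifferentiableAt hzy
  have h3 := (mdifferentiable_chartAt y).mdifferentiableAt_symm (ψ.map_source hzy)
  rw [← mfderiv_eq_fderiv, OneForm.coord_eq_pullback, OneForm.pullback_congr μ hev]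
  exact μ.pullback_comp h3 (h2.comp _ h1)

theorem analyticAt_transition {x y : X} {z : Fin n → ℂ}
    (hz : z ∈ (chartAt (Fin n → ℂ) x).target)
    (hzy : (chartAt (Fin n → ℂ) x).symm z ∈ (chartAt (Fin n → ℂ) y).source) :
    AnalyticAt ℂ (chartAt (Fin n → ℂ) y ∘ (chartAt (Fin n → ℂ) x).symm) z := by
  have h1 : ContMDiffAt 𝓘(ℂ, Fin n → ℂ) 𝓘(ℂ, Fin n → ℂ) ω (chartAt (Fin n → ℂ) x).symm z :=
    contMDiffOn_chart_symm.contMDiffAt ((chartAt (Fin n → ℂ) x).open_target.mem_nhds hz)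
  have h2 : ContMDiffAt 𝓘(ℂ, Fin n → ℂ) 𝓘(ℂ, Fin n → ℂ) ω (chartAt (Fin n → ℂ) y)
      ((chartAt (Fin n → ℂ) x).symm z) :=
    contMDiffOn_chart.contMDiffAt ((chartAt (Fin n → ℂ) y).open_source.mem_nhds hzy)
  exact (contMDiffAt_iff_contDiffAt.mp (h2.comp z h1)).analyticAt

/-- Closedness at a point is preserved by pullback. -/
theorem fderiv_comp_fderiv_symm {W : Type*} [NormedAddCommGroup W] [NormedSpace ℂ W]
    [CompleteSpace W] {a : W → W →L[ℂ] ℂ} {τ : W → W} {z : W}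
    (hτ : AnalyticAt ℂ τ z) (ha : DifferentiableAt ℂ a (τ z))
    (hc : ∀ u v, fderiv ℂ a (τ z) u v = fderiv ℂ a (τ z) v u) (u v : W) :
    fderiv ℂ (fun y => (a (τ y)).comp (fderiv ℂ τ y)) z u v =
      fderiv ℂ (fun y => (a (τ y)).comp (fderiv ℂ τ y)) z v u := by
  have h1 : HasFDerivAt (fun y => a (τ y)) ((fderiv ℂ a (τ z)).comp (fderiv ℂ τ z)) z :=
    ha.hasFDerivAt.comp z hτ.differentiableAt.hasFDerivAt
  have h2 := hτ.fderiv.differentiableAt.hasFDerivAt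
  have h3 : IsSymmSndFDerivAt ℂ τ z := hτ.contDiffAt.isSymmSndFDerivAt (n := ω) (by simp)
  rw [(h1.clm_comp h2).fderiv]
  simp [hc (fderiv ℂ τ z u), h3 u v]

/-- `IsClosedAt` at a nearby point uses the preferred chart of that point, whereas here the chart at
`x` is kept fixed. The transition map links the two, and pullback preserves closedness. -/
theorem closedNear_coord {μ : OneForm n X} {x : X}
    (h : ∀ᶠ y in 𝓝 x, μ.IsClosedHolomorphicAt y) :
    ClosedNear (μ.coord x) (chartAt (Fin n → ℂ) x x) := by
  rw [eventually_nhds_iff_chart n] at h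
  set φ := chartAt (Fin n → ℂ) x
  filter_upwards [h, φ.open_target.mem_nhds (mem_chart_target _ x)] with z ⟨h1, h2⟩ hz u v
  set y := φ.symm z
  set ψ := chartAt (Fin n → ℂ) y
  have hzy : φ.symm z ∈ ψ.source := mem_chart_source _ y
  have hev : μ.coord x =ᶠ[𝓝 z] fun z' => (μ.coord y ((ψ ∘ φ.symm) z')).comp
      (fderiv ℂ (ψ ∘ φ.symm) z') := by
    filter_upwards [(φ.symm.continuousAt (x := z) hz).eventually (ψ.open_source.mem_nhds hzy),
      φ.open_target.mem_nhds hz] with z' hz' hz''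
    exact μ.coord_change hz'' hz'
  rw [hev.fderiv_eq]
  exact fderiv_comp_fderiv_symm (analyticAt_transition hz hzy) h1.differentiableAt h2 u v

theorem coord_differential {F : X → ℂ} {x : X} {z : Fin n → ℂ}
    (hz : z ∈ (chartAt (Fin n → ℂ) x).target)
    (hF : IsHolomorphicAt n F ((chartAt (Fin n → ℂ) x).symm z)) :
    (differential n F).coord x z = fderiv ℂ (F ∘ (chartAt (Fin n → ℂ) x).symm) z := by
  have h1 := (mdifferentiable_chartAt x).mdifferentiableAt_symm hz
  have h2 : MDifferentiableAt 𝓘(ℂ, Fin n → ℂ) 𝓘(ℂ) F ((chartAt (Fin n → ℂ) x).symm z) :=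
    ContMDiffAt.mdifferentiableAt hF (by simp)
  rw [← mfderiv_eq_fderiv, mfderiv_comp z h2 h1]
  rfl

theorem isHolomorphicAt_comp_chart {f : (Fin n → ℂ) → ℂ} {x y : X}
    (hy : y ∈ (chartAt (Fin n → ℂ) x).source) (hf : AnalyticAt ℂ f (chartAt (Fin n → ℂ) x y)) :
    IsHolomorphicAt n (f ∘ chartAt (Fin n → ℂ) x) y := by
  have h2 : ContMDiffAt 𝓘(ℂ, Fin n → ℂ) 𝓘(ℂ, Fin n → ℂ) ω (chartAt (Fin n → ℂ) x) y :=
    contMDiffOn_chart.contMDiffAt ((chartAt (Fin n → ℂ) x).open_source.mem_nhds hy)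
  have h1 : ContMDiffAt 𝓘(ℂ, Fin n → ℂ) 𝓘(ℂ) ω f (chartAt (Fin n → ℂ) x y) :=
    contMDiffAt_iff_contDiffAt.mpr hf.contDiffAt
  exact h1.comp y h2

/-- Holomorphic coefficients are meromorphic germs with denominator `1`. The rigidity argument only
produces holomorphic ones, so this weaker condition suffices. -/
theorem HasOnlyTrivialAbelianRelations.noHolomorphicRelation {μ : Fin m → OneForm n X} {x : X}
    (h : HasOnlyTrivialAbelianRelations μ x) :
    NoHolomorphicRelation (fun i => (μ i).coord x) (chartAt (Fin n → ℂ) x x) := by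
  set φ := chartAt (Fin n → ℂ) x
  intro f hf hsum hpar
  let F : Fin m → MeromorphicGerm n x := fun i =>
    { num := f i ∘ φ
      den := fun _ => 1
      num_holomorphic := isHolomorphicAt_comp_chart (mem_chart_source _ x) (hf i)
      den_holomorphic := contMDiffAt_const
      den_ne_zero := Filter.Frequently.of_forall fun _ => one_ne_zero }
  have hval : ∀ i, (F i).val = f i ∘ φ := fun i => by
    ext y; simp [F, MeromorphicGerm.val]
  have hsrc : ∀ᶠ y in 𝓝 x, y ∈ φ.source := φ.open_source.mem_nhds (mem_chart_source _ x)
  have hφ : Filter.Tendsto φ (𝓝 x) (𝓝 (φ x)) := φ.continuousAt (mem_chart_source _ x)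
  have hF := h F ⟨?_, ?_⟩
  · intro i
    have := eventually_nhds_iff_chart n |>.mp (hF i)
    filter_upwards [this, φ.open_target.mem_nhds (mem_chart_target _ x)] with z hz hzt
    have h0 : f i (φ (φ.symm z)) = 0 := hz
    rwa [φ.right_inv hzt] at h0
  · filter_upwards [hsrc, hφ.eventually hsum] with y hy hs _
    obtain ⟨A, hA, hA'⟩ := exists_coord_eq_comp hy
    ext v
    obtain ⟨u, rfl⟩ := hA v
    have := DFunLike.congr_fun hs u
    simp only [sum_apply, smul_apply] at this
    simp only [sum_apply, smul_apply, hval]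
    simpa [φ, hA'] using this
  · intro i
    filter_upwards [hsrc, hφ.eventually (hpar i), hφ.eventually (hf i).eventually_analyticAt]
      with y hy hp han _ u v
    obtain ⟨A, hA, hA'⟩ := exists_coord_eq_comp hy
    obtain ⟨u, rfl⟩ := hA u
    obtain ⟨v, rfl⟩ := hA v
    have h1 : (differential n (F i).val).coord x (φ y) = fderiv ℂ (f i) (φ y) := by
      rw [coord_differential (φ.map_source hy)
        (by rw [hval, φ.left_inv hy]; exact isHolomorphicAt_comp_chart hy han), hval]
      refine Filter.EventuallyEq.fderiv_eq ?_
      filter_upwards [φ.open_target.mem_nhds (φ.map_source hy)] with z hz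
      simp [φ, φ.right_inv hz]
    have h2 := hp u v
    rw [← h1] at h2
    simp only [φ, hA'] at h2
    exact sub_eq_zero.mpr h2

end Coord

end SymDiff

/-! ### Vanishing, parallelism and propagation for holomorphic 1-forms. -/

namespace SymDiff

theorem analyticAt_smulRight {W V G : Type*} [NormedAddCommGroup W] [NormedSpace ℂ W]
    [NormedAddCommGroup V] [NormedSpace ℂ V] [NormedAddCommGroup G] [NormedSpace ℂ G]
    {f : W → V →L[ℂ] ℂ} {g : W → G} {p : W} (hf : AnalyticAt ℂ f p) (hg : AnalyticAt ℂ g p) :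
    AnalyticAt ℂ (fun z => (f z).smulRight (g z)) p := by
  have h := (ContinuousLinearMap.smulRightL ℂ V G).analyticAt_bilinear (f p, g p)
  exact h.comp₂ hf hg

section Forms

variable {n m : ℕ} {X : Type u} [TopologicalSpace X] [ChartedSpace (Fin n → ℂ) X]
  [IsManifold 𝓘(ℂ, Fin n → ℂ) ω X]

theorem coord_eq_smul_iff {x y : X} (hy : y ∈ (chartAt (Fin n → ℂ) x).source)
    (μ ν : OneForm n X) (c : ℂ) :
    μ.coord x (chartAt (Fin n → ℂ) x y) = c • ν.coord x (chartAt (Fin n → ℂ) x y) ↔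
      μ y = c • ν y := by
  obtain ⟨A, hA, hA'⟩ := exists_coord_eq_comp hy
  rw [hA', hA']
  constructor
  · intro h
    ext v
    obtain ⟨u, rfl⟩ := hA v
    exact DFunLike.congr_fun h u
  · intro h
    rw [h]
    rfl

theorem coord_eq_zero_iff {x y : X} (hy : y ∈ (chartAt (Fin n → ℂ) x).source)
    (μ : OneForm n X) : μ.coord x (chartAt (Fin n → ℂ) x y) = 0 ↔ μ y = 0 := by
  have := coord_eq_smul_iff hy μ μ 0
  rwa [zero_smul ℂ (μ.coord x _), zero_smul ℂ (μ y)] at this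

theorem parallel_coord_iff {x y : X} (hy : y ∈ (chartAt (Fin n → ℂ) x).source)
    (μ ν : OneForm n X) :
    Parallel (μ.coord x (chartAt (Fin n → ℂ) x y)) (ν.coord x (chartAt (Fin n → ℂ) x y)) ↔
      Parallel (μ y) (ν y) := by
  obtain ⟨A, hA, hA'⟩ := exists_coord_eq_comp hy
  rw [hA', hA']
  constructor
  · intro h u v
    obtain ⟨u, rfl⟩ := hA u
    obtain ⟨v, rfl⟩ := hA v
    exact h u v
  · intro h u v
    exact h (A u) (A v)

omit [IsManifold 𝓘(ℂ, Fin n → ℂ) ω X] in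
theorem eventually_mem_chart_source (x : X) : ∀ᶠ y in 𝓝 x, y ∈ (chartAt (Fin n → ℂ) x).source :=
  (chartAt (Fin n → ℂ) x).open_source.mem_nhds (mem_chart_source _ x)

/-- The wedge product of two 1-forms, in the preferred chart at `x`. -/
noncomputable def wedgeCoord (μ ν : OneForm n X) (x y : X) :
    (Fin n → ℂ) →L[ℂ] (Fin n → ℂ) →L[ℂ] ℂ :=
  (μ.coord x (chartAt (Fin n → ℂ) x y)).smulRight (ν.coord x (chartAt (Fin n → ℂ) x y)) -
    (ν.coord x (chartAt (Fin n → ℂ) x y)).smulRight (μ.coord x (chartAt (Fin n → ℂ) x y))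

theorem wedgeCoord_eq_zero_iff {x y : X} (hy : y ∈ (chartAt (Fin n → ℂ) x).source)
    (μ ν : OneForm n X) : wedgeCoord μ ν x y = 0 ↔ Parallel (μ y) (ν y) := by
  rw [← parallel_coord_iff hy]
  constructor
  · intro h u v
    have := DFunLike.congr_fun (DFunLike.congr_fun h u) v
    simp only [wedgeCoord, sub_apply, ContinuousLinearMap.smulRight_apply, smul_apply,
      smul_eq_mul, zero_apply] at this
    linear_combination this
  · intro h
    ext u v
    have := h u v
    simp only [wedgeCoord, sub_apply, ContinuousLinearMap.smulRight_apply, smul_apply,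
      smul_eq_mul, zero_apply]
    linear_combination this

omit [IsManifold 𝓘(ℂ, Fin n → ℂ) ω X] in
theorem chartAnalyticAt_wedgeCoord {x : X} {μ ν : OneForm n X} (hμ : μ.IsHolomorphicAt x)
    (hν : ν.IsHolomorphicAt x) : ChartAnalyticAt n (wedgeCoord μ ν x) x := by
  have h1 : AnalyticAt ℂ _ _ := hμ.chartAnalyticAt
  have h2 : AnalyticAt ℂ _ _ := hν.chartAnalyticAt
  exact (analyticAt_smulRight h1 h2).sub (analyticAt_smulRight h2 h1)

theorem OneForm.IsHolomorphicAt.eq_zero_or_generically_ne_zero {μ : OneForm n X} {x : X}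
    (h : μ.IsHolomorphicAt x) : (∀ᶠ y in 𝓝 x, μ y = 0) ∨ ∀ᶠ y in generically x, μ y ≠ 0 := by
  refine h.chartAnalyticAt.eventually_eq_zero_or_generically_ne_zero.imp (fun h => ?_) fun h => ?_
  · filter_upwards [h, eventually_mem_chart_source (n := n) x] with y h1 h2
    exact (coord_eq_zero_iff h2 μ).mp h1
  · filter_upwards [h, generically_le_nhds x (eventually_mem_chart_source (n := n) x)]
      with y h1 h2
    exact fun h => h1 ((coord_eq_zero_iff h2 μ).mpr h)

/-- Otherwise every form is generically nonzero, and finitely many generic conditions hold together.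
The index that varies with `y` thus becomes a fixed one. -/
theorem exists_eventually_oneForm_eq_zero {μ : Fin m → OneForm n X} {x : X}
    (h : ∀ i, (μ i).IsHolomorphicAt x) (h0 : ∀ᶠ y in generically x, ∃ i, μ i y = 0) :
    ∃ i, ∀ᶠ y in 𝓝 x, μ i y = 0 := by
  by_contra hc
  rw [not_exists] at hc
  have h1 := Filter.eventually_all.mpr fun i =>
    (h i).eq_zero_or_generically_ne_zero.resolve_left (hc i)
  obtain ⟨y, ⟨i, hi⟩, hy⟩ := (h0.and h1).exists
  exact hy i hi

/-- Parallelism is the vanishing of the analytic function `wedgeCoord`. -/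
theorem parallel_or_generically_not_parallel {μ ν : OneForm n X} {x : X}
    (hμ : μ.IsHolomorphicAt x) (hν : ν.IsHolomorphicAt x) :
    (∀ᶠ y in 𝓝 x, Parallel (μ y) (ν y)) ∨ ∀ᶠ y in generically x, ¬ Parallel (μ y) (ν y) := by
  refine (chartAnalyticAt_wedgeCoord hμ hν).eventually_eq_zero_or_generically_ne_zero.imp
    (fun h => ?_) fun h => ?_
  · filter_upwards [h, eventually_mem_chart_source (n := n) x] with y h1 h2
    exact (wedgeCoord_eq_zero_iff h2 μ ν).mp h1
  · filter_upwards [h, generically_le_nhds x (eventually_mem_chart_source (n := n) x)]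
      with y h1 h2
    exact fun h => h1 ((wedgeCoord_eq_zero_iff h2 μ ν).mpr h)

theorem parallel_of_generically {μ ν : OneForm n X} {x : X}
    (hμ : μ.IsHolomorphicAt x) (hν : ν.IsHolomorphicAt x)
    (h : ∀ᶠ y in generically x, Parallel (μ y) (ν y)) : ∀ᶠ y in 𝓝 x, Parallel (μ y) (ν y) := by
  refine (parallel_or_generically_not_parallel hμ hν).resolve_right fun h' => ?_
  obtain ⟨y, h1, h2⟩ := (h.and h').exists
  exact h2 h1

/-- If generically near `x` one of finitely many pairs of forms is parallel, then some pair is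
parallel near `x`. -/
theorem exists_eventually_parallel {ι : Type*} [Finite ι] {μ ν : ι → OneForm n X} {x : X}
    (hμ : ∀ i, (μ i).IsHolomorphicAt x) (hν : ∀ i, (ν i).IsHolomorphicAt x)
    (h : ∀ᶠ y in generically x, ∃ i, Parallel (μ i y) (ν i y)) :
    ∃ i, ∀ᶠ y in 𝓝 x, Parallel (μ i y) (ν i y) := by
  by_contra hc
  rw [not_exists] at hc
  have h1 := Filter.eventually_all.mpr fun i =>
    (parallel_or_generically_not_parallel (hμ i) (hν i)).resolve_left (hc i)
  obtain ⟨y, ⟨i, hi⟩, hy⟩ := (h.and h1).exists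
  exact hy i hi

theorem OneForm.IsHolomorphicAt.propagate {μ ν : OneForm n X} {x : X}
    (hμ : μ.IsHolomorphicAt x) (hν : ν.IsHolomorphicAt x) :
    ∀ᶠ y in 𝓝 x, ∀ c : ℂ, (∀ᶠ z in 𝓝 y, μ z = c • ν z) → ∀ᶠ z in 𝓝 x, μ z = c • ν z := by
  have hs := eventually_mem_chart_source (n := n) x
  filter_upwards [hμ.chartAnalyticAt.propagate hν.chartAnalyticAt,
    eventually_eventually_nhds.mpr hs] with y hy hys c hc
  filter_upwards [hy c (by
    filter_upwards [hc, hys] with z hz hzs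
    exact (coord_eq_smul_iff hzs μ ν c).mpr hz), hs] with z hz hzs
  exact (coord_eq_smul_iff hzs μ ν c).mp hz

end Forms

/-! ### Uniqueness of closed decompositions when the abelian rank is trivial. -/

section Decompositions

variable {n m : ℕ} {X : Type u} [TopologicalSpace X] [ChartedSpace (Fin n → ℂ) X]
  {w : TensorField n m X} {μ ν : Fin m → OneForm n X} {x : X}

theorem IsClosedDecompositionAt.eventually (h : IsClosedDecompositionAt w μ x) :
    ∀ᶠ y in 𝓝 x, IsClosedDecompositionAt w μ y := by
  obtain ⟨U, hU, hx, h1, h2⟩ := h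
  filter_upwards [hU.mem_nhds hx] with y hy
  exact ⟨U, hU, hy, h1, h2⟩

theorem IsClosedDecompositionAt.eventually_closed (h : IsClosedDecompositionAt w μ x) (i : Fin m) :
    ∀ᶠ y in 𝓝 x, (μ i).IsClosedHolomorphicAt y := by
  obtain ⟨U, hU, hx, h1, -⟩ := h
  filter_upwards [hU.mem_nhds hx] with y hy
  exact h1 i y hy

theorem IsClosedDecompositionAt.holomorphic (h : IsClosedDecompositionAt w μ x) (i : Fin m) :
    (μ i).IsHolomorphicAt x :=
  (h.eventually_closed i).self_of_nhds.1

theorem IsClosedDecompositionAt.eq_symProd (h : IsClosedDecompositionAt w μ x) :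
    w x = symProd (fun i => μ i x) := by
  obtain ⟨U, -, hx, -, h2⟩ := h
  exact h2 x hx

theorem IsClosedDecompositionAt.apply_diag (h : IsClosedDecompositionAt w μ x)
    (v : TangentSpace 𝓘(ℂ, Fin n → ℂ) x) : w x (fun _ => v) = ∏ i, μ i x v := by
  rw [h.eq_symProd, symProd_diag]

theorem IsClosedDecompositionAt.comp_perm (h : IsClosedDecompositionAt w μ x)
    (σ : Equiv.Perm (Fin m)) : IsClosedDecompositionAt w (fun i => μ (σ i)) x := by
  obtain ⟨U, hU, hx, h1, h2⟩ := h
  refine ⟨U, hU, hx, fun i => h1 (σ i), fun y hy => ?_⟩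
  rw [h2 y hy, symProd_perm (fun i => μ i y)]

theorem IsAnalyticSubset.isClosed {R : Set X} (h : IsAnalyticSubset n R) : IsClosed R := by
  rw [← isOpen_compl_iff, isOpen_iff_mem_nhds]
  intro x hx
  obtain ⟨U, hU, hxU, k, g, hg, hR⟩ := h x
  have : ¬ ∀ i, g i x = 0 := fun h => hx ((hR x hxU).mpr h)
  push Not at this
  obtain ⟨i, hi⟩ := this
  filter_upwards [hU.mem_nhds hxU,
    (hg i x hxU).continuousAt.eventually_ne hi] with y hy hgy hyR
  exact hgy ((hR y hy).mp hyR i)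

/-- The special points of `w`, with a decomposition without abelian relations, are generic. -/
theorem HasTrivialAbelianRank.generically_special (h : HasTrivialAbelianRank w) (x : X) :
    ∀ᶠ y in generically x, ∃ κ : Fin m → OneForm n X, IsClosedDecompositionAt w κ y ∧
      HasOnlyTrivialAbelianRelations κ y := by
  obtain ⟨R, hR, hint, h⟩ := h
  have hd : Dense Rᶜ := interior_eq_empty_iff_dense_compl.mp hint
  exact (eventually_generically_of_dense hR.isClosed.isOpen_compl hd x).mono fun y hy => h y hy

/-- The factors of the decompositions `μ` and `ν` agree near `x` up to nonzero constants. -/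
def SameUpToConst (μ ν : Fin m → OneForm n X) (x : X) : Prop :=
  ∀ i, ∃ c : ℂ, c ≠ 0 ∧ ∀ᶠ y in 𝓝 x, μ i y = c • ν i y

theorem SameUpToConst.symm (h : SameUpToConst μ ν x) : SameUpToConst ν μ x := fun i => by
  obtain ⟨c, hc, h⟩ := h i
  refine ⟨c⁻¹, inv_ne_zero hc, h.mono fun y hy => ?_⟩
  rw [hy, inv_smul_smul₀ hc]

theorem SameUpToConst.trans {κ : Fin m → OneForm n X} (h : SameUpToConst μ ν x)
    (h' : SameUpToConst ν κ x) : SameUpToConst μ κ x := fun i => by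
  obtain ⟨c, hc, h⟩ := h i
  obtain ⟨d, hd, h'⟩ := h' i
  refine ⟨c * d, mul_ne_zero hc hd, ?_⟩
  filter_upwards [h, h'] with y h1 h2
  rw [h1, h2, smul_smul]

theorem SameUpToConst.refl (μ : Fin m → OneForm n X) (x : X) : SameUpToConst μ μ x := fun i =>
  ⟨1, one_ne_zero, Filter.Eventually.of_forall fun y => (one_smul ℂ (μ i y)).symm⟩

theorem SameUpToConst.comp (h : SameUpToConst μ ν x) (σ : Equiv.Perm (Fin m)) :
    SameUpToConst (fun i => μ (σ i)) (fun i => ν (σ i)) x := fun i => h (σ i)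

theorem SameUpToConst.eventually (h : SameUpToConst μ ν x) :
    ∀ᶠ y in 𝓝 x, SameUpToConst μ ν y := by
  refine Filter.eventually_all.mpr fun i => ?_
  obtain ⟨c, hc, h⟩ := h i
  exact (eventually_eventually_nhds.mpr h).mono fun y hy => ⟨c, hc, hy⟩

theorem SameUpToConst.parallel (h : SameUpToConst μ ν x) (i : Fin m) :
    ∀ᶠ y in 𝓝 x, Parallel (μ i y) (ν i y) := by
  obtain ⟨c, -, h⟩ := h i
  filter_upwards [h] with y hy
  rw [hy]
  exact (Parallel.refl _).smul_left c

variable [IsManifold 𝓘(ℂ, Fin n → ℂ) ω X]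

/-- The factors of a decomposition do not vanish generically. -/
theorem HasTrivialAbelianRank.generically_ne_zero (hw : HasTrivialAbelianRank w)
    (hμ : IsClosedDecompositionAt w μ x) : ∀ᶠ y in generically x, ∀ i, μ i y ≠ 0 := by
  refine Filter.eventually_all.mpr fun i =>
    (hμ.holomorphic i).eq_zero_or_generically_ne_zero.resolve_left fun h0 => ?_
  -- If `μ i` vanished near `x`, so would `w`; at a nearby special point `y`, some factor of the
  -- relation-free decomposition `κ` would then vanish.
  obtain ⟨y, ⟨h0, hμ⟩, κ, hκ, hκ'⟩ := ((generically_le_nhds x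
    ((eventually_eventually_nhds.mpr h0).and (eventually_eventually_nhds.mpr hμ.eventually))).and
      (hw.generically_special x)).exists
  obtain ⟨j, hj⟩ := exists_eventually_oneForm_eq_zero hκ.holomorphic (generically_le_nhds y (by
    filter_upwards [h0, hμ, hκ.eventually] with z hz hμz hκz
    by_contra! hne
    obtain ⟨v, hv⟩ := exists_forall_apply_ne_zero _ hne
    refine Finset.prod_ne_zero_iff.mpr (fun j (_ : j ∈ Finset.univ) => hv j) ?_
    rw [← hκz.apply_diag, hμz.apply_diag, Finset.prod_eq_zero (Finset.mem_univ i)]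
    rw [hz]
    rfl))
  refine not_eventually_eq_zero hκ'.noHolomorphicRelation j ?_
  rw [eventually_nhds_iff_chart n] at hj
  filter_upwards [hj, (chartAt (Fin n → ℂ) y).open_target.mem_nhds (mem_chart_target _ y)]
    with z hz hzt
  rw [← coord_eq_zero_iff ((chartAt (Fin n → ℂ) y).map_target hzt)] at hz
  rwa [(chartAt (Fin n → ℂ) y).right_inv hzt] at hz

omit [IsManifold 𝓘(ℂ, Fin n → ℂ) ω X] in
theorem ne_zero_of_decompositions (hμ : IsClosedDecompositionAt w μ x)
    (hν : IsClosedDecompositionAt w ν x) (h : ∀ i, μ i x ≠ 0) (i : Fin m) : ν i x ≠ 0 := by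
  intro h0
  obtain ⟨v, hv⟩ := exists_forall_apply_ne_zero _ h
  refine Finset.prod_ne_zero_iff.mpr (fun j (_ : j ∈ Finset.univ) => hv j) ?_
  rw [← hμ.apply_diag, hν.apply_diag, Finset.prod_eq_zero (Finset.mem_univ i)]
  rw [h0]
  rfl

theorem exists_coord_apply_ne_zero (h : ∀ i, μ i x ≠ 0) :
    ∃ v, ∀ i, (μ i).coord x (chartAt (Fin n → ℂ) x x) v ≠ 0 :=
  exists_forall_apply_ne_zero (fun i => (μ i).coord x (chartAt (Fin n → ℂ) x x)) fun i h0 =>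
    h i ((coord_eq_zero_iff (mem_chart_source _ x) _).mp h0)

theorem eventually_parallel_coord {α β : OneForm n X} (h : ∀ᶠ y in 𝓝 x, Parallel (α y) (β y)) :
    ∀ᶠ z in 𝓝 (chartAt (Fin n → ℂ) x x), Parallel (α.coord x z) (β.coord x z) := by
  rw [eventually_nhds_iff_chart n] at h
  filter_upwards [h, (chartAt (Fin n → ℂ) x).open_target.mem_nhds (mem_chart_target _ x)]
    with z hz hzt
  rw [← parallel_coord_iff ((chartAt (Fin n → ℂ) x).map_target hzt)] at hz
  rwa [(chartAt (Fin n → ℂ) x).right_inv hzt] at hz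

/-- Distinct factors of a decomposition are not parallel generically. -/
theorem HasTrivialAbelianRank.generically_not_parallel (hw : HasTrivialAbelianRank w)
    (hμ : IsClosedDecompositionAt w μ x) {i j : Fin m} (hij : i ≠ j) :
    ∀ᶠ y in generically x, ¬ Parallel (μ i y) (μ j y) := by
  refine (parallel_or_generically_not_parallel (hμ.holomorphic i)
    (hμ.holomorphic j)).resolve_left fun hpar => ?_
  obtain ⟨y, ⟨hpar, hμy⟩, hne, κ, hκ, hκ'⟩ := ((generically_le_nhds x
    ((eventually_eventually_nhds.mpr hpar).and hμ.eventually)).and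
      ((hw.generically_ne_zero hμ).and (hw.generically_special x))).exists
  -- A parallel pair in `μ` forces one in `κ` at generic points near `y`; as there are finitely many
  -- pairs, a single one is parallel on a neighbourhood.
  obtain ⟨⟨⟨a, b⟩, hab⟩, hp⟩ := exists_eventually_parallel (x := y)
    (μ := fun p : {p : Fin m × Fin m // p.1 ≠ p.2} => κ p.1.1) (ν := fun p => κ p.1.2)
    (fun p => hκ.holomorphic _) (fun p => hκ.holomorphic _) (by
      filter_upwards [generically_le_nhds y hpar, generically_le_nhds y hμy.eventually,
        generically_le_nhds y hκ.eventually, hw.generically_ne_zero hμy] with z h1 h2 h3 h4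
      by_contra! hc
      exact pairwise_not_parallel_of_prod_eq (α := fun i => κ i z) (β := fun i => μ i z)
        (fun v => by rw [← h2.apply_diag, h3.apply_diag]) h4
        (fun a b hab => hc ⟨⟨a, b⟩, hab⟩) i j hij h1)
  obtain ⟨v, hv⟩ := exists_coord_apply_ne_zero (ne_zero_of_decompositions hμy hκ hne)
  exact not_eventually_parallel hκ.holomorphic
    (fun i => closedNear_coord (hκ.eventually_closed i)) hv hκ'.noHolomorphicRelation hab
    (eventually_parallel_coord hp)

/-- A closed decomposition and a holomorphic decomposition up to a scalar function have parallel
factors, after a permutation. -/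
theorem HasTrivialAbelianRank.exists_perm_parallel (hw : HasTrivialAbelianRank w)
    (hμ : IsClosedDecompositionAt w μ x) {α : Fin m → OneForm n X}
    (hα : ∀ i, (α i).IsHolomorphicAt x)
    (h : ∀ᶠ y in generically x, ∃ c : ℂ, ∀ v, w y (fun _ => v) = c * ∏ i, α i y v) :
    ∃ σ : Equiv.Perm (Fin m), ∀ i, ∀ᶠ y in 𝓝 x, Parallel (μ (σ i) y) (α i y) := by
  have hμg := generically_le_nhds x hμ.eventually
  have h1 : ∀ i, ∃ j, ∀ᶠ y in 𝓝 x, Parallel (μ j y) (α i y) := fun i =>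
    exists_eventually_parallel hμ.holomorphic (fun _ => hα i) (by
      filter_upwards [hμg, h] with y hy ⟨c, hc⟩
      exact exists_parallel_of_prod_eq (c := c) (fun v => (hy.apply_diag v).symm.trans (hc v)) i)
  have h2 : ∀ᶠ y in generically x, (∀ i, α i y ≠ 0) ∧ ∀ j, ∃ i, Parallel (α i y) (μ j y) := by
    filter_upwards [hμg, hw.generically_ne_zero hμ, h] with y hy hne ⟨c, hc⟩
    obtain ⟨v, hv⟩ := exists_forall_apply_ne_zero _ hne
    have h3 : c * ∏ i, α i y v ≠ 0 := by
      rw [← hc, hy.apply_diag]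
      exact Finset.prod_ne_zero_iff.mpr fun i _ => hv i
    refine ⟨fun i h0 => right_ne_zero_of_mul h3 (Finset.prod_eq_zero (Finset.mem_univ i) ?_), ?_⟩
    · rw [h0]
      rfl
    · refine exists_parallel_of_prod_eq (c := c⁻¹) fun v => ?_
      rw [← hy.apply_diag, hc, inv_mul_cancel_left₀ (left_ne_zero_of_mul h3)]
  choose σ hσ using h1
  -- `μ j` is parallel to some `α i`, hence to `μ (σ i)`; distinct factors of `μ` are generically
  -- not parallel, so `σ i = j`.
  have hsurj : Function.Surjective σ := fun j => by
    obtain ⟨i, hi⟩ := exists_eventually_parallel hα (fun _ => hμ.holomorphic j)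
      (h2.mono fun y hy => hy.2 j)
    refine ⟨i, ?_⟩
    by_contra hne
    obtain ⟨y, ⟨h3, h4⟩, h5, h6⟩ := ((generically_le_nhds x ((hσ i).and hi)).and
      (h2.and (hw.generically_not_parallel hμ hne))).exists
    exact h6 (h3.trans h4 (h5.1 i))
  exact ⟨Equiv.ofBijective σ ⟨Finite.injective_iff_surjective.mpr hsurj, hsurj⟩, hσ⟩

omit [IsManifold 𝓘(ℂ, Fin n → ℂ) ω X] in
theorem eventually_prod_coord (hμ : IsClosedDecompositionAt w μ x)
    (hν : IsClosedDecompositionAt w ν x) (v : Fin n → ℂ) :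
    ∀ᶠ z in 𝓝 (chartAt (Fin n → ℂ) x x),
      ∏ i, (μ i).coord x z v = ∏ i, (ν i).coord x z v := by
  have h := (eventually_nhds_iff_chart n).mp (hμ.eventually.and hν.eventually)
  filter_upwards [h] with z ⟨h1, h2⟩
  exact (h1.apply_diag _).symm.trans (h2.apply_diag _)

theorem eventually_eq_smul_of_coord {α β : OneForm n X} {c : ℂ}
    (h : ∀ᶠ z in 𝓝 (chartAt (Fin n → ℂ) x x), α.coord x z = c • β.coord x z) :
    ∀ᶠ y in 𝓝 x, α y = c • β y := by
  filter_upwards [eventually_mem_chart_source (n := n) x,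
    ((chartAt (Fin n → ℂ) x).continuousAt (mem_chart_source _ x)).eventually h] with y hy hy'
  exact (coord_eq_smul_iff hy α β c).mp hy'

/-- Closed decompositions with parallel factors agree up to constants. -/
theorem HasTrivialAbelianRank.sameUpToConst (hw : HasTrivialAbelianRank w)
    (hμ : IsClosedDecompositionAt w μ x) (hν : IsClosedDecompositionAt w ν x)
    (hpar : ∀ i, ∀ᶠ y in 𝓝 x, Parallel (μ i y) (ν i y)) : SameUpToConst μ ν x := by
  intro i
  -- Rigidity needs a relation-free decomposition, so the comparison is made at a special point `y`
  -- where no factor vanishes; `hprop` brings the resulting constant back to `x`.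
  obtain ⟨y, ⟨hμy, hνy, hpar, hprop⟩, hne, κ, hκ, hκ'⟩ := ((generically_le_nhds x
    (hμ.eventually.and (hν.eventually.and ((eventually_eventually_nhds.mpr
      (Filter.eventually_all.mpr hpar)).and ((hμ.holomorphic i).propagate
        (hν.holomorphic i)))))).and
      ((hw.generically_ne_zero hμ).and (hw.generically_special x))).exists
  have hκne := ne_zero_of_decompositions hμy hκ hne
  have hνne := ne_zero_of_decompositions hμy hνy hne
  obtain ⟨τ, hτ⟩ := hw.exists_perm_parallel hνy hκ.holomorphic (generically_le_nhds y (by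
    filter_upwards [hκ.eventually] with z hz
    exact ⟨1, fun v => by rw [hz.apply_diag, one_mul]⟩))
  obtain ⟨v, hv⟩ := exists_coord_apply_ne_zero hκne
  have key : ∀ {α : Fin m → OneForm n X}, IsClosedDecompositionAt w α y →
      (∀ i, ∀ᶠ z in 𝓝 y, Parallel (α i z) (κ i z)) → ∀ i, ∃ c : ℂ,
        ∀ᶠ z in 𝓝 y, α i z = c • κ i z := fun {α} hα hp i => by
    obtain ⟨c, hc⟩ := eventually_eq_const_smul hα.holomorphic hκ.holomorphic
      (fun i => closedNear_coord (hα.eventually_closed i))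
      (fun i => closedNear_coord (hκ.eventually_closed i)) hv
      (fun i => eventually_parallel_coord (hp i)) (eventually_prod_coord hα hκ v)
      hκ'.noHolomorphicRelation i
    exact ⟨c, eventually_eq_smul_of_coord hc⟩
  have hνev : ∀ i, ∀ᶠ z in generically y, ν i z ≠ 0 := fun i =>
    (hw.generically_ne_zero hνy).mono fun z hz => hz i
  -- At index `τ.symm i` the permuted families show `ν i` and `μ i`, both constant multiples of the
  -- same factor of `κ`.
  obtain ⟨d, hd⟩ := key (hνy.comp_perm τ) hτ (τ.symm i)
  obtain ⟨c, hc⟩ := key (hμy.comp_perm τ) (fun k => parallel_of_generically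
    (hμy.holomorphic _) (hκ.holomorphic _) (by
      filter_upwards [generically_le_nhds y (hτ k), generically_le_nhds y hpar, hνev (τ k)]
        with z h1 h2 h3
      exact (h2 (τ k)).trans h1 h3)) (τ.symm i)
  rw [Equiv.apply_symm_apply] at hc hd
  have hd0 : d ≠ 0 := by
    rintro rfl
    apply hνne i
    rw [hd.self_of_nhds, zero_smul ℂ (κ _ y)]
  have hc0 : c ≠ 0 := by
    rintro rfl
    apply hne i
    rw [hc.self_of_nhds, zero_smul ℂ (κ _ y)]
  refine ⟨c / d, div_ne_zero hc0 hd0, hprop _ ?_⟩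
  filter_upwards [hc, hd] with z h1 h2
  rw [h1, h2, smul_smul, div_mul_cancel₀ _ hd0]

/-- Two closed decompositions agree up to a permutation and constants. -/
theorem HasTrivialAbelianRank.exists_perm (hw : HasTrivialAbelianRank w)
    (hμ : IsClosedDecompositionAt w μ x) (hν : IsClosedDecompositionAt w ν x) :
    ∃ σ : Equiv.Perm (Fin m), SameUpToConst μ (fun i => ν (σ i)) x := by
  obtain ⟨σ, hσ⟩ := hw.exists_perm_parallel hν hμ.holomorphic (generically_le_nhds x (by
    filter_upwards [hμ.eventually] with z hz
    exact ⟨1, fun v => by rw [hz.apply_diag, one_mul]⟩))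
  exact ⟨σ, (hw.sameUpToConst (hν.comp_perm σ) hμ hσ).symm⟩

theorem HasTrivialAbelianRank.perm_eq (hw : HasTrivialAbelianRank w)
    (hμ : IsClosedDecompositionAt w μ x) {σ τ : Equiv.Perm (Fin m)}
    (h : SameUpToConst (fun i => μ (σ i)) (fun i => μ (τ i)) x) : σ = τ := by
  ext1 i
  by_contra hne
  obtain ⟨y, h1, h2⟩ := ((generically_le_nhds x (h.parallel i)).and
    (hw.generically_not_parallel hμ hne)).exists
  exact h2 h1

/-- Both decompositions have the same diagonal value, nonzero at a suitable point and vector. This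
is what trivializes the tensor product of the local systems. -/
theorem HasTrivialAbelianRank.prod_eq_one (hw : HasTrivialAbelianRank w)
    (hμ : IsClosedDecompositionAt w μ x) (hν : IsClosedDecompositionAt w ν x) {c : Fin m → ℂ}
    (h : ∀ i, ∀ᶠ y in 𝓝 x, μ i y = c i • ν i y) : ∏ i, c i = 1 := by
  obtain ⟨y, ⟨h1, h2, h3⟩, h4⟩ := ((generically_le_nhds x ((Filter.eventually_all.mpr h).and
    (hμ.eventually.and hν.eventually))).and (hw.generically_ne_zero hν)).exists
  obtain ⟨v, hv⟩ := exists_forall_apply_ne_zero _ h4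
  have h5 := (h2.apply_diag v).symm.trans (h3.apply_diag v)
  simp only [h1, smul_apply, smul_eq_mul, Finset.prod_mul_distrib] at h5
  exact mul_right_cancel₀ (Finset.prod_ne_zero_iff.mpr fun i _ => hv i) (h5.trans (one_mul _).symm)

theorem HasTrivialAbelianRank.const_eq (hw : HasTrivialAbelianRank w)
    (hν : IsClosedDecompositionAt w ν x) {i : Fin m} {α : OneForm n X} {c d : ℂ}
    (hc : ∀ᶠ y in 𝓝 x, α y = c • ν i y) (hd : ∀ᶠ y in 𝓝 x, α y = d • ν i y) : c = d := by
  obtain ⟨y, ⟨h1, h2⟩, h3⟩ := ((generically_le_nhds x (hc.and hd)).and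
    (hw.generically_ne_zero hν)).exists
  exact smul_left_injective ℂ (h3 i) (h1.symm.trans h2)

end Decompositions

end SymDiff

namespace SymDiff

/-! ### From a consistent labelling of factors to twisted closed forms. -/

section Labelling

variable {n m : ℕ} {X X' : Type u} [TopologicalSpace X] [ChartedSpace (Fin n → ℂ) X]
  [TopologicalSpace X'] [ChartedSpace (Fin n → ℂ) X']
  {w : TensorField n m X} {f : X' → X}

theorem TensorField.pullback_eq_symProd {μ : Fin m → OneForm n X} {x : X'}
    (h : w (f x) = symProd (fun i => μ i (f x))) :
    w.pullback f x = symProd (fun i => (μ i).pullback f x) := by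
  unfold TensorField.pullback
  rw [h]
  ext v
  simp only [symProd, ContinuousMultilinearMap.compContinuousLinearMap_apply, smul_apply,
    sum_apply]
  rfl

variable [IsManifold 𝓘(ℂ, Fin n → ℂ) ω X']

/-- By `hpt` and `hchart` the chart at `x` is the lift of the chart at `f x`, so `μ` and its
pullback have the same coordinate expression. -/
theorem OneForm.IsClosedHolomorphicAt.pullback {μ : OneForm n X} {x : X'}
    (hf : ∀ᶠ y in 𝓝 x, MDifferentiableAt 𝓘(ℂ, Fin n → ℂ) 𝓘(ℂ, Fin n → ℂ) f y)
    (hpt : chartAt (Fin n → ℂ) x x = chartAt (Fin n → ℂ) (f x) (f x))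
    (hchart : f ∘ (chartAt (Fin n → ℂ) x).symm =ᶠ[𝓝 (chartAt (Fin n → ℂ) x x)]
      (chartAt (Fin n → ℂ) (f x)).symm)
    (hμ : μ.IsClosedHolomorphicAt (f x)) : (μ.pullback f).IsClosedHolomorphicAt x := by
  have hev : (μ.pullback f).coord x =ᶠ[𝓝 (chartAt (Fin n → ℂ) x x)] μ.coord (f x) := by
    filter_upwards [eventually_eventually_nhds.mpr hchart, (eventually_nhds_iff_chart n).mp hf,
      (chartAt (Fin n → ℂ) x).open_target.mem_nhds (mem_chart_target _ x)] with z h1 h2 h3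
    rw [OneForm.coord_eq_pullback, OneForm.coord_eq_pullback,
      ← OneForm.pullback_comp μ h2 ((mdifferentiable_chartAt x).mdifferentiableAt_symm h3)]
    exact μ.pullback_congr h1
  constructor
  · exact AnalyticAt.congr (hpt ▸ hμ.1) hev.symm
  · intro u v
    rw [hev.fderiv_eq, hpt]
    exact hμ.2 u v

variable [IsManifold 𝓘(ℂ, Fin n → ℂ) ω X]

open Classical in
/-- The constant `c` with `α = c β` near `x`, if there is one. -/
noncomputable def ratio (α β : OneForm n X) (x : X) : ℂ :=
  if h : ∃ c : ℂ, c ≠ 0 ∧ ∀ᶠ y in 𝓝 x, α y = c • β y then h.choose else 1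

omit [IsManifold 𝓘(ℂ, Fin n → ℂ) ω X] in
theorem SameUpToConst.ratio_spec {μ ν : Fin m → OneForm n X} {x : X} (h : SameUpToConst μ ν x)
    (i : Fin m) : ratio (μ i) (ν i) x ≠ 0 ∧
      ∀ᶠ y in 𝓝 x, μ i y = ratio (μ i) (ν i) x • ν i y := by
  unfold ratio
  rw [dif_pos (h i)]
  exact (h i).choose_spec

/-- A closed decomposition of `w` at the points `f x'` that depends on `x'` in a locally constant
way, up to constants, yields a twisted closed decomposition of the pullback. -/
theorem HasTrivialAbelianRank.hasTwistedClosedDecomposition_pullback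
    (hw : HasTrivialAbelianRank w)
    (hf : MDifferentiable 𝓘(ℂ, Fin n → ℂ) 𝓘(ℂ, Fin n → ℂ) f)
    (hpt : ∀ x, chartAt (Fin n → ℂ) x x = chartAt (Fin n → ℂ) (f x) (f x))
    (hchart : ∀ x, f ∘ (chartAt (Fin n → ℂ) x).symm =ᶠ[𝓝 (chartAt (Fin n → ℂ) x x)]
      (chartAt (Fin n → ℂ) (f x)).symm)
    (Λ : X' → Fin m → OneForm n X) (hΛ : ∀ x, IsClosedDecompositionAt w (Λ x) (f x))
    (hloc : ∀ x, ∀ᶠ y in 𝓝 x, SameUpToConst (Λ x) (Λ y) (f y)) :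
    HasTwistedClosedDecomposition (w.pullback f) := by
  have hcont : Continuous f := hf.continuous
  -- The cover is indexed by the points of `X'`: over `U a` the decomposition `Λ a` is valid and has
  -- the same labels as the local `Λ y`.
  let S : X' → Set X' := fun a =>
    {y | SameUpToConst (Λ a) (Λ y) (f y) ∧ IsClosedDecompositionAt w (Λ a) (f y)}
  let U : X' → Set X' := fun a => interior (S a)
  have hsame : ∀ a b, ∀ x ∈ U a ∩ U b, SameUpToConst (Λ a) (Λ b) (f x) := fun a b x hx =>
    (interior_subset hx.1).1.trans (interior_subset hx.2).1.symm
  have hdec : ∀ a, ∀ x ∈ U a, IsClosedDecompositionAt w (Λ a) (f x) := fun a x hx =>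
    (interior_subset hx).2
  have hg := fun a b x (hx : x ∈ U a ∩ U b) k => (hsame a b x hx).ratio_spec k
  -- The transition functions are the ratios of factors with equal label; their uniqueness gives
  -- local constancy and the cocycle rule. They multiply to `1`, so the constant `1` trivializes the
  -- tensor product.
  refine ⟨X', U, ⟨fun a => isOpen_interior, fun x => ⟨x, mem_interior_iff_mem_nhds.mpr
    ((hloc x).and (hcont.continuousAt.eventually (hΛ x).eventually))⟩⟩,
    fun k => ⟨fun a b x => ratio (Λ a k) (Λ b k) (f x), fun a b x hx => (hg a b x hx k).1, ?_, ?_⟩,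
    fun k a => (Λ a k).pullback f, fun _ _ => 1, fun k => ⟨?_, ?_⟩, ⟨?_, ?_⟩, ?_⟩
  · intro a b x hx
    filter_upwards [(isOpen_interior.inter isOpen_interior).mem_nhds hx,
      hcont.continuousAt.eventually (eventually_eventually_nhds.mpr (hg a b x hx k).2)]
      with y hy hy'
    exact hw.const_eq (hdec b y hy.2) (hg a b y hy k).2 hy'
  · intro a b c x hx
    refine hw.const_eq (hdec c x hx.2) (i := k) (α := Λ a k) ?_ (hg a c x ⟨hx.1.1, hx.2⟩ k).2
    filter_upwards [(hg a b x hx.1 k).2, (hg b c x ⟨hx.1.2, hx.2⟩ k).2] with y h1 h2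
    rw [h1, mul_smul, ← h2]
  · intro a x hx
    exact ((hdec a x hx).eventually_closed k).self_of_nhds.pullback
      (Filter.Eventually.of_forall hf) (hpt x) (hchart x)
  · intro a b x hx
    ext v
    exact DFunLike.congr_fun (hg a b x hx k).2.self_of_nhds _
  · exact fun a x hx => ⟨one_ne_zero, Filter.Eventually.of_forall fun _ => rfl⟩
  · intro a b x hx
    have := hw.prod_eq_one (hdec a x hx.1) (hdec b x hx.2) (fun k => (hg a b x hx k).2)
    simpa using this.symm
  · intro a x hx
    rw [one_smul]
    exact TensorField.pullback_eq_symProd (hdec a x hx).eq_symProd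

omit [IsManifold 𝓘(ℂ, Fin n → ℂ) ω X] in
theorem TensorField.pullback_id (w : TensorField n m X) : w.pullback id = w := by
  ext x v
  simp only [TensorField.pullback, ContinuousMultilinearMap.compContinuousLinearMap_apply,
    mfderiv_id]
  rfl

theorem HasTrivialAbelianRank.hasTwistedClosedDecomposition
    (hw : HasTrivialAbelianRank w) (Λ : X → Fin m → OneForm n X)
    (hΛ : ∀ x, IsClosedDecompositionAt w (Λ x) x)
    (hloc : ∀ x, ∀ᶠ y in 𝓝 x, SameUpToConst (Λ x) (Λ y) y) :
    HasTwistedClosedDecomposition w := by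
  have := hw.hasTwistedClosedDecomposition_pullback (f := id) mdifferentiable_id (fun _ => rfl)
    (fun _ => Filter.EventuallyEq.rfl) Λ hΛ hloc
  rwa [TensorField.pullback_id] at this

end Labelling

/-! ### Split differentials: the labelling exists on `X` itself. -/

section Split

variable {n m : ℕ} {X : Type u} [TopologicalSpace X] [ChartedSpace (Fin n → ℂ) X]
  [IsManifold 𝓘(ℂ, Fin n → ℂ) ω X] {w : TensorField n m X}

/-- If the factors of `w` are globally labelled by the fields `ψ` of linear forms, in the sense
that near every point `w` is generically a multiple of a product of holomorphic forms that are
parallel to the `ψ i`, then `w` has a twisted closed decomposition. -/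
theorem HasTrivialAbelianRank.hasTwistedClosedDecomposition_of_label
    (hw : HasTrivialAbelianRank w) (hfirst : IsFirstKind w) (ψ : Fin m → OneForm n X)
    (hψ : ∀ x, ∃ α : Fin m → OneForm n X, (∀ i, (α i).IsHolomorphicAt x) ∧
      ∀ᶠ y in generically x, (∃ c : ℂ, ∀ v, w y (fun _ => v) = c * ∏ i, α i y v) ∧
        ∀ i, ψ i y ≠ 0 ∧ Parallel (α i y) (ψ i y)) :
    HasTwistedClosedDecomposition w := by
  have key : ∀ x, ∃ μ : Fin m → OneForm n X, IsClosedDecompositionAt w μ x ∧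
      ∀ᶠ y in generically x, ∀ i, ψ i y ≠ 0 ∧ Parallel (μ i y) (ψ i y) := by
    intro x
    obtain ⟨μ, hμ⟩ := hfirst x
    obtain ⟨α, hα, h⟩ := hψ x
    obtain ⟨σ, hσ⟩ := hw.exists_perm_parallel hμ hα (h.mono fun y hy => hy.1)
    refine ⟨fun i => μ (σ i), hμ.comp_perm σ, ?_⟩
    filter_upwards [h, generically_le_nhds x (Filter.eventually_all.mpr hσ),
      generically_le_nhds x hμ.eventually, hw.generically_ne_zero hμ]
      with y ⟨⟨c, hc⟩, h1⟩ h2 h3 h4 i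
    have hαne : α i y ≠ 0 := fun h0 => by
      obtain ⟨v, hv⟩ := exists_forall_apply_ne_zero _ h4
      refine Finset.prod_ne_zero_iff.mpr (fun j (_ : j ∈ Finset.univ) => hv j) ?_
      rw [← h3.apply_diag, hc, Finset.prod_eq_zero (Finset.mem_univ i), mul_zero]
      rw [h0]
      rfl
    exact ⟨(h1 i).1, (h2 i).trans (h1 i).2 hαne⟩
  choose Λ hΛ hΛψ using key
  refine hw.hasTwistedClosedDecomposition Λ hΛ fun x => ?_
  -- Near `y`, `Λ x i` and `Λ y i` are both generically parallel to the same nonzero `ψ i`, hence to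
  -- each other.
  filter_upwards [(hΛ x).eventually, eventually_eventually_generically (hΛψ x)] with y hy hy'
  refine hw.sameUpToConst hy (hΛ y) fun i =>
    parallel_of_generically (hy.holomorphic i) ((hΛ y).holomorphic i) ?_
  filter_upwards [hy', hΛψ y] with z h1 h2
  exact (h1 i).2.trans (h2 i).2.symm (h1 i).1

theorem HasTrivialAbelianRank.hasTwistedClosedDecomposition_of_isMeromorphicallySplit
    (hw : HasTrivialAbelianRank w) (hfirst : IsFirstKind w) (h : IsMeromorphicallySplit w) :
    HasTwistedClosedDecomposition w := by
  obtain ⟨ψ, hψ, D, hD, hdense, hprod⟩ := h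
  refine hw.hasTwistedClosedDecomposition_of_label hfirst ψ fun x => ?_
  choose α b hα hb hb0 hψα using fun k => hψ k x
  -- The numerators `α k` are the holomorphic forms required; generically they differ from `ψ k` by
  -- a nonzero factor.
  have hbg : ∀ k, ∀ᶠ y in generically x, b k y ≠ 0 := fun k =>
    (chartAnalyticAt_of_isHolomorphicAt (hb k)).eventually_eq_zero_or_generically_ne_zero
      |>.resolve_left fun h0 => hb0 k (h0.mono fun y hy => not_not.mpr hy)
  obtain ⟨μ, hμ⟩ := hfirst x
  refine ⟨α, hα, ?_⟩
  filter_upwards [Filter.eventually_all.mpr hbg, eventually_generically_of_dense hD hdense x,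
    generically_le_nhds x (Filter.eventually_all.mpr hψα), hw.generically_ne_zero hμ,
    generically_le_nhds x hμ.eventually] with y h1 h2 h3 h4 h5
  refine ⟨⟨∏ k, (b k y)⁻¹, fun v => ?_⟩, fun k => ⟨fun h0 => ?_, ?_⟩⟩
  · rw [hprod y h2, symProd_diag, ← Finset.prod_mul_distrib]
    refine Finset.prod_congr rfl fun k _ => ?_
    rw [h3 k (h1 k)]
    rfl
  · obtain ⟨v, hv⟩ := exists_forall_apply_ne_zero _ h4
    refine Finset.prod_ne_zero_iff.mpr (fun j (_ : j ∈ Finset.univ) => hv j) ?_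
    rw [← h5.apply_diag, hprod y h2, symProd_diag, Finset.prod_eq_zero (Finset.mem_univ k)]
    rw [h0]
    rfl
  · rw [h3 k (h1 k)]
    exact ((Parallel.refl _).smul_left _).symm

theorem HasTrivialAbelianRank.hasTwistedClosedDecomposition_of_isLineBundleSplit
    (hw : HasTrivialAbelianRank w) (hfirst : IsFirstKind w) (h : IsLineBundleSplit w) :
    HasTwistedClosedDecomposition w := by
  obtain ⟨ι, U, ⟨hU, hcov⟩, L, μ, t, hμ, ht, hprod⟩ := h
  choose a ha using hcov
  -- The frame `a y` is chosen arbitrarily at each point. Changing it only rescales the form, so the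
  -- label needs no continuity.
  refine hw.hasTwistedClosedDecomposition_of_label hfirst (fun k y => μ k (a y) y) fun x => ?_
  obtain ⟨κ, hκ⟩ := hfirst x
  refine ⟨fun k => μ k (a x), fun k => (hμ k).1 _ x (ha x), ?_⟩
  filter_upwards [generically_le_nhds x ((hU (a x)).mem_nhds (ha x)), hw.generically_ne_zero hκ,
    generically_le_nhds x hκ.eventually] with y hy h4 h5
  have h6 : ∀ v, w y (fun _ => v) = t (a x) y * ∏ k, μ k (a x) y v := fun v => by
    rw [hprod (a x) y hy, smul_apply, symProd_diag]
    rfl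
  have h7 : ∀ k, μ k (a x) y = (L k).g (a x) (a y) y • μ k (a y) y := fun k =>
    (hμ k).2 _ _ y ⟨hy, ha y⟩
  refine ⟨⟨_, h6⟩, fun k => ⟨fun h0 => ?_, ?_⟩⟩
  · obtain ⟨v, hv⟩ := exists_forall_apply_ne_zero _ h4
    refine Finset.prod_ne_zero_iff.mpr (fun j (_ : j ∈ Finset.univ) => hv j) ?_
    rw [← h5.apply_diag, h6, Finset.prod_eq_zero (Finset.mem_univ k), mul_zero]
    rw [h7, h0]
    exact mul_zero _
  · rw [h7]
    exact (Parallel.refl _).smul_left _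

end Split

end SymDiff

namespace SymDiff

/-! ### Topology of finite coverings. -/

section Covering

variable {E X : Type*} [TopologicalSpace E] [TopologicalSpace X] {f : E → X}

/-- Each of the finitely many sheets over `x` lies in `N` above some neighbourhood of `x`; the
intersection of these neighbourhoods works for the whole fibre. -/
theorem isClosedMap_of_isCoveringMap (hf : IsCoveringMap f) (hfin : ∀ x, (f ⁻¹' {x}).Finite) :
    IsClosedMap f := by
  rw [isClosedMap_iff_comap_nhds_le]
  intro x N hN
  obtain ⟨hd, U, hxU, hU, hfU, H, hH⟩ := hf x
  have : Finite (f ⁻¹' {x}) := hfin x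
  rw [mem_nhdsSet_iff_forall] at hN
  have h1 : ∀ i : f ⁻¹' {x}, ∀ᶠ u in 𝓝 (⟨x, hxU⟩ : U), (H.symm (u, i)).1 ∈ N := fun i => by
    have hc : Continuous fun u : U => (H.symm (u, i)).1 :=
      continuous_subtype_val.comp (H.symm.continuous.comp (Continuous.prodMk_left i))
    refine hc.continuousAt.eventually (hN _ ?_)
    rw [Set.mem_preimage, ← hH, H.apply_symm_apply]
    rfl
  have h2 := Filter.eventually_all.mpr h1
  rw [nhds_subtype_eq_comap, Filter.eventually_comap] at h2
  refine ⟨_, h2.and (hU.mem_nhds hxU), fun e ⟨he, heU⟩ => ?_⟩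
  have h3 := he ⟨f e, heU⟩ rfl (H ⟨e, heU⟩).2
  have h4 : ((⟨f e, heU⟩ : U), (H ⟨e, heU⟩).2) = H ⟨e, heU⟩ := 
    Prod.ext (Subtype.ext (hH ⟨e, heU⟩).symm) rfl
  rwa [h4, H.symm_apply_apply] at h3

/-- Countably many evenly covered sets suffice, and the preimage of each is its product with a
finite discrete fibre. -/
theorem secondCountableTopology_of_isCoveringMap [SecondCountableTopology X]
    (hf : IsCoveringMap f) (hfin : ∀ x, (f ⁻¹' {x}).Finite) : SecondCountableTopology E := by
  choose hd U hxU hU hfU H hH using hf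
  obtain ⟨s, hs, hcov⟩ := TopologicalSpace.countable_cover_nhds fun x => (hU x).mem_nhds (hxU x)
  have : Countable s := hs
  have h1 : ∀ x : s, SecondCountableTopology (f ⁻¹' U x) := fun x => by
    have : Finite (f ⁻¹' {x.1}) := hfin x
    have := hd x
    exact (H x).secondCountableTopology
  refine TopologicalSpace.secondCountableTopology_of_countable_cover (ι := s)
    (U := fun x => f ⁻¹' U x) (fun x => hfU x) ?_
  rw [Set.eq_univ_iff_forall] at hcov ⊢
  intro e
  obtain ⟨x, hx, hex⟩ := Set.mem_iUnion₂.mp (hcov (f e))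
  exact Set.mem_iUnion.mpr ⟨⟨x, hx⟩, hex⟩

theorem t2Space_of_isCoveringMap [T2Space X] (hf : IsCoveringMap f) : T2Space E := by
  refine ⟨fun a b hab => ?_⟩
  by_cases h : f a = f b
  · exact hf.isSeparatedMap a b h hab
  · exact separated_by_continuous hf.continuous h

/-- The restriction of a finite covering to an open and closed subset. -/
theorem isCoveringMap_restrict_isClopen [T2Space X] (hf : IsCoveringMap f)
    (hfin : ∀ x, (f ⁻¹' {x}).Finite) {C : Set E} (hC : IsClopen C) :
    IsCoveringMap (fun e : C => f e) ∧ ∀ x, ((fun e : C => f e) ⁻¹' {x}).Finite := by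
  have := t2Space_of_isCoveringMap hf
  have h1 : ∀ x, ((fun e : C => f e) ⁻¹' {x}).Finite := fun x =>
    Set.Finite.preimage (f := ((↑) : C → E)) Subtype.val_injective.injOn (hfin x)
  have h2 : IsClosedMap (fun e : C => f e) :=
    (isClosedMap_of_isCoveringMap hf hfin).comp hC.1.isClosedMap_subtype_val
  have h3 : IsLocalHomeomorph (fun e : C => f e) :=
    hf.isLocalHomeomorph.comp hC.2.isOpenEmbedding_subtypeVal.isLocalHomeomorph
  -- A closed local homeomorphism with finite fibres from a Hausdorff space is a covering.
  refine ⟨isCoveringMap_iff_isCoveringMapOn_univ.mpr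
    (h2.isCoveringMapOn_of_isLocalHomeomorphOn (fun x _ => h1 x) ?_), h1⟩
  rw [Set.preimage_univ]
  exact isLocalHomeomorph_iff_isLocalHomeomorphOn_univ.mp h3

/-- A finite covering of a locally connected space contains a finite covering that is connected if
the base is. -/
theorem exists_isClopen_connected [T2Space X] [LocallyConnectedSpace E] (hf : IsCoveringMap f)
    (hfin : ∀ x, (f ⁻¹' {x}).Finite) (hsurj : Function.Surjective f) :
    ∃ C : Set E, IsClopen C ∧ Function.Surjective (fun e : C => f e) ∧
      (ConnectedSpace X → ConnectedSpace C) := by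
  by_cases hX : ConnectedSpace X
  · obtain ⟨x⟩ := hX.toNonempty
    obtain ⟨e, -⟩ := hsurj x
    have hC : IsClopen (connectedComponent e) := ⟨isClosed_connectedComponent,
      isOpen_connectedComponent⟩
    refine ⟨connectedComponent e, hC, ?_, fun _ => isConnected_iff_connectedSpace.mp
      isConnected_connectedComponent⟩
    -- A finite covering is open and closed, so a clopen component has clopen image, which is all of
    -- the connected base.
    have h1 : IsClopen (f '' connectedComponent e) :=
      ⟨isClosedMap_of_isCoveringMap hf hfin _ hC.1, hf.isOpenMap _ hC.2⟩
    have h2 := h1.eq_univ ⟨f e, e, mem_connectedComponent, rfl⟩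
    intro y
    obtain ⟨e', he', rfl⟩ := h2.symm ▸ Set.mem_univ y
    exact ⟨⟨e', he'⟩, rfl⟩
  · refine ⟨Set.univ, isClopen_univ, fun x => ?_, fun h => absurd h hX⟩
    obtain ⟨e, rfl⟩ := hsurj x
    exact ⟨⟨e, trivial⟩, rfl⟩

end Covering

/-! ### The complex structure lifted along a local homeomorphism. -/

section Manifold

variable {n : ℕ} {E X : Type u} [TopologicalSpace E] [TopologicalSpace X]
  [ChartedSpace (Fin n → ℂ) X] {f : E → X}

/-- The charts of the base, lifted along a local homeomorphism. -/
noncomputable abbrev liftChartedSpace (n : ℕ) {E X : Type u} [TopologicalSpace E]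
    [TopologicalSpace X] [ChartedSpace (Fin n → ℂ) X] {f : E → X} (hf : IsLocalHomeomorph f) :
    ChartedSpace (Fin n → ℂ) E where
  atlas := Set.range fun e => (hf e).choose ≫ₕ chartAt (Fin n → ℂ) (f e)
  chartAt e := (hf e).choose ≫ₕ chartAt (Fin n → ℂ) (f e)
  mem_chart_source e := by
    have h := (hf e).choose_spec
    rw [OpenPartialHomeomorph.trans_source]
    refine ⟨h.1, ?_⟩
    rw [Set.mem_preimage, ← congrFun h.2 e]
    exact mem_chart_source _ _
  chart_mem_atlas e := ⟨e, rfl⟩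

/-- The data of a lift of the charts of `X` along `f`. -/
theorem liftChartedSpace_spec (hf : IsLocalHomeomorph f) (e : E) :
    letI := liftChartedSpace n hf
    ∃ φ : OpenPartialHomeomorph E X, e ∈ φ.source ∧ f = φ ∧
      chartAt (Fin n → ℂ) e = φ ≫ₕ chartAt (Fin n → ℂ) (f e) :=
  ⟨_, (hf e).choose_spec.1, (hf e).choose_spec.2, rfl⟩

theorem isManifold_liftChartedSpace [IsManifold 𝓘(ℂ, Fin n → ℂ) ω X] (hf : IsLocalHomeomorph f) :
    letI := liftChartedSpace n hf
    IsManifold 𝓘(ℂ, Fin n → ℂ) ω E := by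
  let := liftChartedSpace n hf
  refine isManifold_of_contDiffOn _ _ _ ?_
  rintro _ _ ⟨a, rfl⟩ ⟨b, rfl⟩
  have ha := (hf a).choose_spec
  have hb := (hf b).choose_spec
  set φ := (hf a).choose
  set ψ := (hf b).choose
  intro z hz
  -- Since `φ` and `ψ` both equal `f`, they cancel, and the lifted transition maps are restrictions
  -- of those of `X`.
  have hz' : ∀ y ∈ ((φ ≫ₕ chartAt (Fin n → ℂ) (f a)).symm ≫ₕ
      (ψ ≫ₕ chartAt (Fin n → ℂ) (f b))).source, y ∈ (chartAt (Fin n → ℂ) (f a)).target ∧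
      ψ (φ.symm ((chartAt (Fin n → ℂ) (f a)).symm y)) = (chartAt (Fin n → ℂ) (f a)).symm y ∧
      (chartAt (Fin n → ℂ) (f a)).symm y ∈ (chartAt (Fin n → ℂ) (f b)).source := by
    intro y hy
    simp only [mfld_simps] at hy
    have h1 : ψ (φ.symm ((chartAt (Fin n → ℂ) (f a)).symm y)) =
        (chartAt (Fin n → ℂ) (f a)).symm y := by
      rw [← congrFun hb.2, congrFun ha.2, φ.right_inv hy.1.2]
    refine ⟨hy.1.1, h1, ?_⟩
    rw [← h1]
    exact hy.2.2
  simp only [mfld_simps, modelWithCornersSelf_coe, modelWithCornersSelf_coe_symm] at hz ⊢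
  have hz0 := hz' z (by simpa only [mfld_simps] using hz)
  refine ((analyticAt_transition hz0.1 hz0.2.2).contDiffAt.contDiffWithinAt).congr
    (fun y hy => ?_) ?_
  · exact congrArg _ (hz' y (by simpa only [mfld_simps] using hy)).2.1
  · exact congrArg _ hz0.2.1

theorem isLocalDiffeomorph_liftChartedSpace [IsManifold 𝓘(ℂ, Fin n → ℂ) ω X]
    (hf : IsLocalHomeomorph f) :
    letI := liftChartedSpace n hf
    IsLocalDiffeomorph 𝓘(ℂ, Fin n → ℂ) 𝓘(ℂ, Fin n → ℂ) ω f := by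
  let := liftChartedSpace n hf
  have := isManifold_liftChartedSpace (n := n) hf
  have hs : ∀ e : E, ContMDiffAt 𝓘(ℂ, Fin n → ℂ) 𝓘(ℂ, Fin n → ℂ) ω f e := fun e => by
    obtain ⟨φ, he, hφ, hc⟩ := liftChartedSpace_spec (n := n) hf e
    have h1 : ContMDiffAt 𝓘(ℂ, Fin n → ℂ) 𝓘(ℂ, Fin n → ℂ) ω (chartAt (Fin n → ℂ) e) e :=
      contMDiffOn_chart.contMDiffAt
        ((chartAt (Fin n → ℂ) e).open_source.mem_nhds (mem_chart_source _ e))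
    have h0 : chartAt (Fin n → ℂ) e e ∈ (chartAt (Fin n → ℂ) (f e)).target := by
      rw [hc, OpenPartialHomeomorph.trans_apply, ← congrFun hφ]
      exact mem_chart_target _ _
    have h2 : ContMDiffAt 𝓘(ℂ, Fin n → ℂ) 𝓘(ℂ, Fin n → ℂ) ω (chartAt (Fin n → ℂ) (f e)).symm
        (chartAt (Fin n → ℂ) e e) :=
      contMDiffOn_chart_symm.contMDiffAt ((chartAt (Fin n → ℂ) (f e)).open_target.mem_nhds h0)
    refine (h2.comp e h1).congr_of_eventuallyEq ?_
    filter_upwards [(chartAt (Fin n → ℂ) e).open_source.mem_nhds (mem_chart_source _ e)]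
      with y hy
    rw [hc] at hy ⊢
    rw [OpenPartialHomeomorph.trans_source] at hy
    rw [Function.comp_apply, OpenPartialHomeomorph.trans_apply, congrFun hφ y]
    exact ((chartAt (Fin n → ℂ) (f e)).left_inv hy.2).symm
  intro e
  obtain ⟨φ, he, hφ, -⟩ := liftChartedSpace_spec (n := n) hf e
  refine ⟨⟨φ.toPartialEquiv, φ.open_source, φ.open_target, ?_, ?_⟩, he, fun y _ => congrFun hφ y⟩
  · intro y hy
    exact (hφ ▸ hs y).contMDiffWithinAt
  · intro x hx
    refine ContMDiffAt.contMDiffWithinAt ?_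
    obtain ⟨y, hy, rfl⟩ : ∃ y ∈ φ.source, φ y = x := ⟨_, φ.map_target hx, φ.right_inv hx⟩
    obtain ⟨ψ, hyψ, hψ, hc⟩ := liftChartedSpace_spec (n := n) hf y
    have hx' : φ y = f y := (congrFun hφ y).symm
    have h1 : ContMDiffAt 𝓘(ℂ, Fin n → ℂ) 𝓘(ℂ, Fin n → ℂ) ω (chartAt (Fin n → ℂ) (f y))
        (φ y) := by
      rw [hx']
      exact contMDiffOn_chart.contMDiffAt
        ((chartAt (Fin n → ℂ) (f y)).open_source.mem_nhds (mem_chart_source _ (f y)))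
    have h0 : chartAt (Fin n → ℂ) (f y) (φ y) ∈ (chartAt (Fin n → ℂ) y).target := by
      have : chartAt (Fin n → ℂ) (f y) (φ y) = chartAt (Fin n → ℂ) y y := by
        rw [hc, OpenPartialHomeomorph.trans_apply, ← congrFun hψ, hx']
      rw [this]
      exact mem_chart_target _ _
    have h2 : ContMDiffAt 𝓘(ℂ, Fin n → ℂ) 𝓘(ℂ, Fin n → ℂ) ω (chartAt (Fin n → ℂ) y).symm
        (chartAt (Fin n → ℂ) (f y) (φ y)) :=
      contMDiffOn_chart_symm.contMDiffAt ((chartAt (Fin n → ℂ) y).open_target.mem_nhds h0)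
    refine (h2.comp (φ y) h1).congr_of_eventuallyEq ?_
    have h3 : ∀ᶠ x in 𝓝 (φ y), φ.symm x ∈ (chartAt (Fin n → ℂ) y).source := by
      refine (φ.symm.continuousAt hx).eventually ?_
      rw [φ.left_inv hy]
      exact (chartAt (Fin n → ℂ) y).open_source.mem_nhds (mem_chart_source _ y)
    filter_upwards [h3, φ.open_target.mem_nhds hx] with x hx1 hx2
    have h4 : chartAt (Fin n → ℂ) y (φ.symm x) = chartAt (Fin n → ℂ) (f y) x := by
      rw [hc, OpenPartialHomeomorph.trans_apply, ← congrFun hψ, congrFun hφ (φ.symm x),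
        φ.right_inv hx2]
    rw [Function.comp_apply, ← h4, (chartAt (Fin n → ℂ) y).left_inv hx1]
    rfl

theorem liftChartedSpace_apply_self (hf : IsLocalHomeomorph f) (e : E) :
    letI := liftChartedSpace n hf
    chartAt (Fin n → ℂ) e e = chartAt (Fin n → ℂ) (f e) (f e) := by
  let := liftChartedSpace n hf
  obtain ⟨φ, he, hφ, hc⟩ := liftChartedSpace_spec (n := n) hf e
  rw [hc, OpenPartialHomeomorph.trans_apply, ← congrFun hφ]

theorem liftChartedSpace_comp_symm (hf : IsLocalHomeomorph f) (e : E) :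
    letI := liftChartedSpace n hf
    f ∘ (chartAt (Fin n → ℂ) e).symm =ᶠ[𝓝 (chartAt (Fin n → ℂ) e e)]
      (chartAt (Fin n → ℂ) (f e)).symm := by
  let := liftChartedSpace n hf
  obtain ⟨φ, he, hφ, hc⟩ := liftChartedSpace_spec (n := n) hf e
  filter_upwards [(chartAt (Fin n → ℂ) e).open_target.mem_nhds (mem_chart_target _ e)] with z hz
  rw [hc] at hz ⊢
  rw [OpenPartialHomeomorph.trans_target] at hz
  rw [Function.comp_apply, OpenPartialHomeomorph.trans_symm_eq_symm_trans_symm,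
    OpenPartialHomeomorph.trans_apply, congrFun hφ, φ.right_inv hz.2]

end Manifold

end SymDiff

/-! ### The monodromy covering of orderings of the factors. -/

namespace SymDiff

/-- The orderings of the factors of a decomposition, as a discrete space. -/
@[ext]
structure Ordering (m : ℕ) where
  perm : Equiv.Perm (Fin m)

instance (m : ℕ) : TopologicalSpace (Ordering m) := ⊥

instance (m : ℕ) : DiscreteTopology (Ordering m) := ⟨rfl⟩

instance (m : ℕ) : Finite (Ordering m) :=
  Finite.of_injective Ordering.perm fun _ _ => Ordering.ext

section Monodromy

variable {n m : ℕ} {X : Type u} [TopologicalSpace X] [ChartedSpace (Fin n → ℂ) X]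
  [IsManifold 𝓘(ℂ, Fin n → ℂ) ω X] {w : TensorField n m X}

open Classical in
/-- The permutation that matches the factors of `μ` near `x` with those of `ν`. -/
noncomputable def matching (μ ν : Fin m → OneForm n X) (x : X) : Equiv.Perm (Fin m) :=
  if h : ∃ σ : Equiv.Perm (Fin m), SameUpToConst μ (fun i => ν (σ i)) x then h.choose else 1

theorem HasTrivialAbelianRank.matching_spec (hw : HasTrivialAbelianRank w)
    {μ ν : Fin m → OneForm n X} {x : X} (hμ : IsClosedDecompositionAt w μ x)
    (hν : IsClosedDecompositionAt w ν x) :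
    SameUpToConst μ (fun i => ν (matching μ ν x i)) x := by
  have h := hw.exists_perm hμ hν
  unfold matching
  rw [dif_pos h]
  exact h.choose_spec

/-- Uniqueness of the matching yields both its local constancy and its cocycle rule. -/
theorem HasTrivialAbelianRank.matching_eq (hw : HasTrivialAbelianRank w)
    {μ ν : Fin m → OneForm n X} {x : X} (hμ : IsClosedDecompositionAt w μ x)
    (hν : IsClosedDecompositionAt w ν x) {σ : Equiv.Perm (Fin m)}
    (h : SameUpToConst μ (fun i => ν (σ i)) x) : matching μ ν x = σ :=
  hw.perm_eq hν ((hw.matching_spec hμ hν).symm.trans h)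

omit [IsManifold 𝓘(ℂ, Fin n → ℂ) ω X] in
theorem isClosedDecompositionAt_of_mem_interior {μ : Fin m → OneForm n X} {y : X}
    (h : y ∈ interior {y | IsClosedDecompositionAt w μ y}) : IsClosedDecompositionAt w μ y :=
  interior_subset (s := {y | IsClosedDecompositionAt w μ y}) h

/-- The principal bundle of the orderings of the factors of `w`, where `μ x` is a closed
decomposition of `w` at `x`. -/
noncomputable def orderingBundle (hw : HasTrivialAbelianRank w) (μ : X → Fin m → OneForm n X)
    (hμ : ∀ x, IsClosedDecompositionAt w (μ x) x) : FiberBundleCore X X (Ordering m) where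
  baseSet a := interior {y | IsClosedDecompositionAt w (μ a) y}
  isOpen_baseSet a := isOpen_interior
  indexAt x := x
  mem_baseSet_at x := mem_interior_iff_mem_nhds.mpr (hμ x).eventually
  -- The `i`-th form `μ a (τ i)` corresponds to `μ b (matching (τ i))`, so matchings act on the
  -- left.
  coordChange a b y τ := ⟨matching (μ a) (μ b) y * τ.perm⟩
  coordChange_self a y hy τ := by
    have h : IsClosedDecompositionAt w (μ a) y := isClosedDecompositionAt_of_mem_interior hy
    have h1 : matching (μ a) (μ a) y = 1 := hw.matching_eq h h (SameUpToConst.refl _ _)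
    rw [h1, one_mul]
  continuousOn_coordChange a b := by
    rintro ⟨y, τ⟩ ⟨⟨ha, hb⟩, -⟩
    have ha' : IsClosedDecompositionAt w (μ a) y := isClosedDecompositionAt_of_mem_interior ha
    have hb' : IsClosedDecompositionAt w (μ b) y := isClosedDecompositionAt_of_mem_interior hb
    have h := hw.matching_spec ha' hb'
    refine ContinuousAt.continuousWithinAt ?_
    refine tendsto_nhds_of_eventually_eq ?_
    have h1 : ∀ᶠ z in 𝓝 y, matching (μ a) (μ b) z = matching (μ a) (μ b) y := by
      filter_upwards [h.eventually, ha'.eventually, hb'.eventually] with z h1 h2 h3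
      exact hw.matching_eq h2 h3 h1
    have h2 : ∀ᶠ σ in 𝓝 τ, σ = τ := by rw [nhds_discrete]; rfl
    rw [nhds_prod_eq]
    filter_upwards [h1.prod_mk h2] with p hp
    rw [hp.1, hp.2]
  coordChange_comp a b c y hy τ := by
    have ha : IsClosedDecompositionAt w (μ a) y := isClosedDecompositionAt_of_mem_interior hy.1.1
    have hb : IsClosedDecompositionAt w (μ b) y := isClosedDecompositionAt_of_mem_interior hy.1.2
    have hc : IsClosedDecompositionAt w (μ c) y := isClosedDecompositionAt_of_mem_interior hy.2
    have h1 : matching (μ a) (μ c) y = matching (μ b) (μ c) y * matching (μ a) (μ b) y :=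
      hw.matching_eq ha hc ((hw.matching_spec ha hb).trans ((hw.matching_spec hb hc).comp _))
    rw [h1, mul_assoc]

/-- There is a finite covering over which the factors of `w` can be ordered globally. -/
theorem HasTrivialAbelianRank.exists_labelled_covering (hw : HasTrivialAbelianRank w)
    (hfirst : IsFirstKind w) :
    ∃ (E : Type u) (_ : TopologicalSpace E) (f : E → X), IsCoveringMap f ∧
      Function.Surjective f ∧ (∀ x, (f ⁻¹' {x}).Finite) ∧
      ∃ Λ : E → Fin m → OneForm n X, (∀ e, IsClosedDecompositionAt w (Λ e) (f e)) ∧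
        ∀ e, ∀ᶠ e' in 𝓝 e, SameUpToConst (Λ e) (Λ e') (f e') := by
  choose μ hμ using hfirst
  let Z := orderingBundle hw μ hμ
  refine ⟨Z.TotalSpace, inferInstance, Z.proj, FiberBundle.isCoveringMap, fun x =>
    ⟨⟨x, (⟨1⟩ : Ordering m)⟩, rfl⟩, fun x => ?_,
    fun e i => μ e.1 (Ordering.perm e.2 i), fun e => (hμ e.1).comp_perm _, ?_⟩
  · refine (Set.finite_range fun τ : Ordering m => (⟨x, τ⟩ : Z.TotalSpace)).subset ?_
    rintro ⟨y, τ⟩ rfl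
    exact ⟨τ, rfl⟩
  · rintro ⟨x, τ⟩
    have h1 := (Z.localTrivAt x).continuousAt (Z.mk_mem_localTrivAt_source x τ)
    have h2 : ∀ᶠ e' in 𝓝 (⟨x, τ⟩ : Z.TotalSpace), ((Z.localTrivAt x) e').2 = τ := by
      have h3 : Filter.Tendsto (fun e' => ((Z.localTrivAt x) e').2)
          (𝓝 (⟨x, τ⟩ : Z.TotalSpace)) (𝓝 (τ : Ordering m)) := by
        have h0 : ((Z.localTrivAt x) ⟨x, τ⟩).2 = τ :=
          congrArg Prod.snd (Z.localTrivAt_apply_mk x τ)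
        have h : Filter.Tendsto (fun e' => ((Z.localTrivAt x) e').2)
            (𝓝 (⟨x, τ⟩ : Z.TotalSpace)) (𝓝 ((Z.localTrivAt x) ⟨x, τ⟩).2) :=
          continuous_snd.continuousAt.comp h1
        rwa [h0] at h
      have h5 : ∀ᶠ σ : Ordering m in 𝓝 (τ : Ordering m), σ = τ := by
        rw [nhds_discrete]
        rfl
      exact h3.eventually h5
    have h4 : ∀ᶠ e' in 𝓝 (⟨x, τ⟩ : Z.TotalSpace), IsClosedDecompositionAt w (μ x) e'.1 :=
      Z.continuous_proj.continuousAt.eventually (hμ x).eventually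
    filter_upwards [h2, h4] with ⟨y, τ'⟩ h5 h6
    -- On the sheet through `(x, τ)`, the ordering `τ'` of the factors of `μ y` becomes `τ` when
    -- they are matched with those of `μ x`, so the labels agree.
    have h7 : (⟨matching (μ y) (μ x) y * Ordering.perm τ'⟩ : Ordering m) = τ := h5
    rw [← h7]
    exact ((hw.matching_spec (hμ y) h6).comp (Ordering.perm τ')).symm

end Monodromy

end SymDiff

theorem corollary1p2 {n m : ℕ} {X : Type u} [TopologicalSpace X] [T2Space X]
    [SecondCountableTopology X] [ChartedSpace (Fin n → ℂ) X]
    [IsManifold 𝓘(ℂ, Fin n → ℂ) ω X]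
    (w : SymDiff.TensorField n m X) (hw : SymDiff.IsSymmetricDifferential w)
    (hfirst : SymDiff.IsFirstKind w) (hrank : SymDiff.HasTrivialAbelianRank w) :
    (∃ (X' : Type u) (_ : TopologicalSpace X') (_ : ChartedSpace (Fin n → ℂ) X') (f : X' → X),
        T2Space X' ∧ SecondCountableTopology X' ∧ IsManifold 𝓘(ℂ, Fin n → ℂ) ω X' ∧
        (ConnectedSpace X → ConnectedSpace X') ∧
        SymDiff.IsFiniteUnramifiedCover n f ∧
        SymDiff.HasTwistedClosedDecomposition (SymDiff.TensorField.pullback f w)) ∧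
      (SymDiff.IsSplit w → SymDiff.HasTwistedClosedDecomposition w) := by
  refine ⟨?_, fun h => h.elim
    (hrank.hasTwistedClosedDecomposition_of_isMeromorphicallySplit hfirst)
    (hrank.hasTwistedClosedDecomposition_of_isLineBundleSplit hfirst)⟩
  obtain ⟨E, _, f, hf, hsurj, hfin, Λ, hΛ, hloc⟩ := hrank.exists_labelled_covering hfirst
  -- Lifted charts are used on `E` only to make its components open; the final complex structure is
  -- lifted to `C` directly.
  have : LocallyConnectedSpace E := by
    let := SymDiff.liftChartedSpace n hf.isLocalHomeomorph
    exact ChartedSpace.locallyConnectedSpace (Fin n → ℂ) E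
  obtain ⟨C, hC, hCsurj, hconn⟩ := SymDiff.exists_isClopen_connected hf hfin hsurj
  obtain ⟨hg, hgfin⟩ := SymDiff.isCoveringMap_restrict_isClopen hf hfin hC
  have hgl := hg.isLocalHomeomorph
  let := SymDiff.liftChartedSpace n hgl
  have hman := SymDiff.isManifold_liftChartedSpace (n := n) hgl
  have hdiff := SymDiff.isLocalDiffeomorph_liftChartedSpace (n := n) hgl
  refine ⟨C, inferInstance, inferInstance, fun e => f e, SymDiff.t2Space_of_isCoveringMap hg,
    SymDiff.secondCountableTopology_of_isCoveringMap hg hgfin, hman, hconn,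
    ⟨hg, hCsurj, hgfin, hdiff⟩, ?_⟩
  exact hrank.hasTwistedClosedDecomposition_pullback (hdiff.mdifferentiable (by simp))
    (SymDiff.liftChartedSpace_apply_self hgl) (SymDiff.liftChartedSpace_comp_symm hgl)
    (fun e => Λ e) (fun e => hΛ e) fun e => continuous_subtype_val.continuousAt.eventually (hloc e)
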